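/- **Theorem 3.1.** For $n\ge 1$ let $\mathcal B_n$ be Artin's braid group with generators $\sigma_1,\dots,\sigma_{n-1}$. For $q\in\mathbb C$ let $\mathcal H_n(q)$ be the unital $\mathbb C$-algebra with generators $g_1,\dots,g_{n-1}$ and relations $g_ig_{i+1}g_i=g_{i+1}g_ig_{i+1}$, $g_ig_j=g_jg_i$ for $|i-j|>1$, and $(g_i+1)(g_i-q)=0$. Let $\mathcal H_\infty(q)=\bigcup_n\mathcal H_n(q)$ and, for $q\neq-1$, put $e_i=(q-g_i)/(1+q)$. A *Markov trace* with parameter $\eta\in\mathbb C$ is a linear functional $\mathrm{tr}$ on $\mathcal H_\infty(q)$ with $\mathrm{tr}(1)=1$, $\mathrm{tr}(ab)=\mathrm{tr}(ba)$, and $\mathrm{tr}(xe_n)=\eta\,\mathrm{tr}(x)$ for all $n\ge1$ and $x\in\mathcal H_n(q)$. Let $q=e^{2\pi i/6}$ and $\eta=\dfrac{1-q^{-2}}{(1+q)(1-q^3)}$. Then $\eta=1/2$, and there is exactly one Markov trace $\mathrm{tr}$ with parameter $\eta$ on $\mathcal H_\infty(q)$. For $n\ge1$ let $$\mathcal H_n(3,6)=\mathcal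 H_n(q)/\{a\in\mathcal H_n(q):\ \mathrm{tr}(ab)=0\ \text{for all } b\in\mathcal H_n(q)\}.$$ A *Jones–Wenzl representation* of $\mathcal H_n(3,6)$ is a representation $\rho$ of $\mathcal H_n(3,6)$ on a finite-dimensional complex Hilbert space $V$ such that every $\rho(e_i)$ is self-adjoint and $V$ is a direct sum of irreducible representations of $\mathcal H_n(3,6)$ in which every isomorphism class of irreducible representations of $\mathcal H_n(3,6)$ occurs exactly once. Then for every $n\ge 1$ a Jones–Wenzl representation of $\mathcal H_n(3,6)$ exists. For every such $\rho$, on a space $V$, $\rho$ is faithful, and the representation $\phi_n:\mathcal B_n\to GL(V)$ determined by $\phi_n(\sigma_i)=\rho(g_i)$ is unitary and has finite image: $\phi_n(\mathcal B_n)$ is a finite group. -/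

import Mathlib

/-- The relations of the braid group on `n` strands, on the letters `σ_1, …, σ_{n-1}`;
the letter `i : Fin (n - 1)` stands for `σ_{i+1}`. -/
inductive BraidRelator (n : ℕ) : FreeGroup (Fin (n - 1)) → Prop
  | braid (i j : Fin (n - 1)) (h : (j : ℕ) = i + 1) :
      BraidRelator n
        ((FreeGroup.of i * FreeGroup.of j * FreeGroup.of i) *
          (FreeGroup.of j * FreeGroup.of i * FreeGroup.of j)⁻¹)
  | comm (i j : Fin (n - 1)) (h : (i : ℕ) + 1 < j) :
      BraidRelator n
        ((FreeGroup.of i * FreeGroup.of j) * (FreeGroup.of j * FreeGroup.of i)⁻¹)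

/-- Artin's braid group `𝓑_n` on `n` strands. -/
abbrev BraidGroup (n : ℕ) : Type :=
  PresentedGroup {r : FreeGroup (Fin (n - 1)) | BraidRelator n r}

/-- The Hecke algebra relations on generators indexed by `I`, where `pos i` is the place of the
`i`-th generator on the line. -/
inductive HeckeRel {I : Type} (pos : I → ℕ) (q : ℂ) : FreeAlgebra ℂ I → FreeAlgebra ℂ I → Prop
  | braid (i j : I) (h : pos j = pos i + 1) :
      HeckeRel pos q
        (FreeAlgebra.ι ℂ i * FreeAlgebra.ι ℂ j * FreeAlgebra.ι ℂ i)
        (FreeAlgebra.ι ℂ j * FreeAlgebra.ι ℂ i * FreeAlgebra.ι ℂ j)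
  | comm (i j : I) (h : pos i + 1 < pos j) :
      HeckeRel pos q
        (FreeAlgebra.ι ℂ i * FreeAlgebra.ι ℂ j)
        (FreeAlgebra.ι ℂ j * FreeAlgebra.ι ℂ i)
  | quad (i : I) :
      HeckeRel pos q
        ((FreeAlgebra.ι ℂ i + 1) * (FreeAlgebra.ι ℂ i - algebraMap ℂ (FreeAlgebra ℂ I) q)) 0

/-- The complex Hecke algebra (of type A) with generators indexed by `I`. -/
def HeckeAlg {I : Type} (pos : I → ℕ) (q : ℂ) : Type := RingQuot (HeckeRel pos q)

noncomputable instance {I : Type} (pos : I → ℕ) (q : ℂ) : Ring (HeckeAlg pos q) :=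
  inferInstanceAs (Ring (RingQuot (HeckeRel pos q)))

noncomputable instance {I : Type} (pos : I → ℕ) (q : ℂ) : Algebra ℂ (HeckeAlg pos q) :=
  inferInstanceAs (Algebra ℂ (RingQuot (HeckeRel pos q)))

/-- The Hecke algebra `𝓗_n(q)`, generated by `g_1, …, g_{n-1}`. -/
abbrev HeckeFin (n : ℕ) (q : ℂ) : Type := HeckeAlg (fun i : Fin (n - 1) => (i : ℕ)) q

/-- The Hecke algebra `𝓗_∞(q)`, generated by `g_1, g_2, …`: the direct limit of the `𝓗_n(q)`. -/
abbrev HeckeInf (q : ℂ) : Type := HeckeAlg (fun i : ℕ => i) q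

namespace HeckeAlg

variable {I : Type} {pos : I → ℕ} {q : ℂ}

/-- The quotient map from the free algebra. -/
noncomputable def ofFree (pos : I → ℕ) (q : ℂ) : FreeAlgebra ℂ I →ₐ[ℂ] HeckeAlg pos q :=
  RingQuot.mkAlgHom ℂ (HeckeRel pos q)

theorem ofFree_rel {x y : FreeAlgebra ℂ I} (h : HeckeRel pos q x y) :
    ofFree pos q x = ofFree pos q y :=
  RingQuot.mkAlgHom_rel ℂ h

/-- The generator `g_i`. -/
noncomputable def g (pos : I → ℕ) (q : ℂ) (i : I) : HeckeAlg pos q :=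
  ofFree pos q (FreeAlgebra.ι ℂ i)

/-- The element `e_i = (q - g_i) / (1 + q)`, used for `q ≠ -1`. -/
noncomputable def e (pos : I → ℕ) (q : ℂ) (i : I) : HeckeAlg pos q :=
  (1 + q)⁻¹ • (algebraMap ℂ (HeckeAlg pos q) q - g pos q i)

theorem g_braid (i j : I) (h : pos j = pos i + 1) :
    g pos q i * g pos q j * g pos q i = g pos q j * g pos q i * g pos q j := by
  simpa [g] using ofFree_rel (HeckeRel.braid (pos := pos) (q := q) i j h)

theorem g_comm (i j : I) (h : pos i + 1 < pos j) :
    g pos q i * g pos q j = g pos q j * g pos q i := by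
  simpa [g] using ofFree_rel (HeckeRel.comm (pos := pos) (q := q) i j h)

theorem g_quad (i : I) :
    (g pos q i + 1) * (g pos q i - algebraMap ℂ (HeckeAlg pos q) q) = 0 := by
  have h := ofFree_rel (HeckeRel.quad (pos := pos) (q := q) i)
  rw [map_mul, map_add, map_sub, map_one, map_zero, AlgHom.commutes] at h
  exact h

/-- The generator `g_i` as a unit, with inverse `q⁻¹ (g_i + 1 - q)`. -/
noncomputable def gUnit (pos : I → ℕ) (q : ℂ) (hq : q ≠ 0) (i : I) : (HeckeAlg pos q)ˣ where
  val := g pos q i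
  inv := q⁻¹ • (g pos q i + 1 - algebraMap ℂ (HeckeAlg pos q) q)
  val_inv := by
    have h := g_quad (pos := pos) (q := q) i
    have h2 : g pos q i * (g pos q i + 1 - algebraMap ℂ (HeckeAlg pos q) q)
        = algebraMap ℂ (HeckeAlg pos q) q := by
      rw [← sub_eq_zero, ← h]
      simp only [mul_sub, mul_add, add_mul, mul_one, one_mul]
      abel
    rw [mul_smul_comm, h2, Algebra.algebraMap_eq_smul_one, smul_smul, inv_mul_cancel₀ hq, one_smul]
  inv_val := by
    have h := g_quad (pos := pos) (q := q) i
    have hc : algebraMap ℂ (HeckeAlg pos q) q * g pos q i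
        = g pos q i * algebraMap ℂ (HeckeAlg pos q) q := Algebra.commutes q _
    have h2 : (g pos q i + 1 - algebraMap ℂ (HeckeAlg pos q) q) * g pos q i
        = algebraMap ℂ (HeckeAlg pos q) q := by
      rw [sub_mul, hc, ← sub_eq_zero, ← h]
      simp only [mul_sub, add_mul, one_mul]
      abel
    rw [smul_mul_assoc, h2, Algebra.algebraMap_eq_smul_one, smul_smul, inv_mul_cancel₀ hq, one_smul]

end HeckeAlg

/-- The canonical homomorphism `𝓗_n(q) → 𝓗_∞(q)`, `g_i ↦ g_i`. -/
noncomputable def heckeIncl (n : ℕ) (q : ℂ) : HeckeFin n q →ₐ[ℂ] HeckeInf q :=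
  RingQuot.liftAlgHom ℂ
    ⟨FreeAlgebra.lift ℂ (fun i : Fin (n - 1) => HeckeAlg.g (fun i : ℕ => i) q (i : ℕ)), by
      intro x y h
      induction h with
      | braid i j h => simpa using HeckeAlg.g_braid (pos := fun i : ℕ => i) (q := q) _ _ h
      | comm i j h => simpa using HeckeAlg.g_comm (pos := fun i : ℕ => i) (q := q) _ _ h
      | quad i =>
        rw [map_mul, map_add, map_sub, map_one, map_zero, AlgHom.commutes, FreeAlgebra.lift_ι_apply]
        exact HeckeAlg.g_quad (pos := fun i : ℕ => i) (q := q) _⟩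

/-- The homomorphism `𝓑_n → 𝓗_n(q)ˣ`, `σ_i ↦ g_i`. -/
noncomputable def braidToHecke (n : ℕ) (q : ℂ) (hq : q ≠ 0) : BraidGroup n →* (HeckeFin n q)ˣ :=
  PresentedGroup.toGroup (f := HeckeAlg.gUnit (fun i : Fin (n - 1) => (i : ℕ)) q hq) (by
    intro r hr
    induction hr with
    | braid i j h =>
      simp only [map_mul, map_inv, FreeGroup.lift_apply_of]
      rw [mul_inv_eq_one]
      exact Units.ext (HeckeAlg.g_braid i j h)
    | comm i j h =>
      simp only [map_mul, map_inv, FreeGroup.lift_apply_of]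
      rw [mul_inv_eq_one]
      exact Units.ext (HeckeAlg.g_comm i j h))

/-- A Markov trace with parameter `η` on `𝓗_∞(q)`: `tr 1 = 1`, `tr (a b) = tr (b a)`, and
`tr (x e_n) = η tr x` for `n ≥ 1` and `x` in the image of `𝓗_n(q)`. In `markov`, `e_{m+1}` carries the index `m`. -/
structure MarkovTrace (q η : ℂ) where
  tr : HeckeInf q →ₗ[ℂ] ℂ
  tr_one : tr 1 = 1
  tr_mul_comm : ∀ a b, tr (a * b) = tr (b * a)
  markov : ∀ (m : ℕ) (x : HeckeFin (m + 1) q),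
    tr (heckeIncl (m + 1) q x * HeckeAlg.e (fun i : ℕ => i) q m) =
      η * tr (heckeIncl (m + 1) q x)

/-- The annihilator in `𝓗_n(q)` of the restricted trace: all `a` with `tr (a b) = 0` for
every `b ∈ 𝓗_n(q)`. -/
noncomputable def MarkovTrace.ann {q η : ℂ} (t : MarkovTrace q η) (n : ℕ) :
    TwoSidedIdeal (HeckeFin n q) :=
  TwoSidedIdeal.mk' {a | ∀ b, t.tr (heckeIncl n q (a * b)) = 0}
    (by intro b; simp)
    (by
      intro x y hx hy b
      rw [add_mul, map_add, map_add, hx b, hy b, add_zero])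
    (by
      intro x hx b
      rw [neg_mul, map_neg, map_neg, hx b, neg_zero])
    (by
      intro x y hy b
      rw [mul_assoc, map_mul, t.tr_mul_comm, ← map_mul, mul_assoc]
      exact hy _)
    (by
      intro x y hx b
      rw [mul_assoc]
      exact hx _)

/-- `q = e^{2πi/ℓ}`. -/
noncomputable def rootParam (ℓ : ℕ) : ℂ := Complex.exp (2 * Real.pi * Complex.I / ℓ)

theorem rootParam_ne_zero (ℓ : ℕ) : rootParam ℓ ≠ 0 := Complex.exp_ne_zero _

/-- `η = (1 - q^{1-k}) / ((1 + q) (1 - q^k))` for `q = e^{2πi/ℓ}`. -/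
noncomputable def etaParam (k ℓ : ℕ) : ℂ :=
  (1 - rootParam ℓ ^ (1 - (k : ℤ))) / ((1 + rootParam ℓ) * (1 - rootParam ℓ ^ k))

/-- The `(k,ℓ)`-quotient `𝓗_n(k,ℓ) = 𝓗_n(q) / Ann(tr)`. -/
abbrev KLQuotient {k ℓ : ℕ} (t : MarkovTrace (rootParam ℓ) (etaParam k ℓ)) (n : ℕ) : Type :=
  (t.ann n).ringCon.Quotient

namespace KLQuotient

variable {k ℓ : ℕ} (t : MarkovTrace (rootParam ℓ) (etaParam k ℓ)) (n : ℕ)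

/-- The quotient map `𝓗_n(q) → 𝓗_n(k,ℓ)`. -/
noncomputable def mk : HeckeFin n (rootParam ℓ) →+* KLQuotient t n := (t.ann n).ringCon.mk'

/-- The image of `e_i` in `𝓗_n(k,ℓ)`. -/
noncomputable def e (i : Fin (n - 1)) : KLQuotient t n :=
  mk t n (HeckeAlg.e (fun i : Fin (n - 1) => (i : ℕ)) (rootParam ℓ) i)

/-- The homomorphism `𝓑_n → 𝓗_n(k,ℓ)ˣ`, `σ_i ↦ g_i`. -/
noncomputable def ofBraid : BraidGroup n →* (KLQuotient t n)ˣ :=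
  (Units.map (mk t n : HeckeFin n (rootParam ℓ) →* KLQuotient t n)).comp
    (braidToHecke n (rootParam ℓ) (rootParam_ne_zero ℓ))

end KLQuotient

/-- A representation of `𝓗_n(k,ℓ)` on a finite-dimensional Hilbert space `V`, given by the module
structure of `V`, is the Jones–Wenzl representation `ρ^{(k,ℓ)}` if every `e_i` acts as a
self-adjoint operator and `V` is the direct sum of the irreducible representations of `𝓗_n(k,ℓ)`,
each isomorphism class occurring exactly once. -/
structure IsJonesWenzl {k ℓ : ℕ} (t : MarkovTrace (rootParam ℓ) (etaParam k ℓ)) (n : ℕ)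
    (V : Type*) [NormedAddCommGroup V] [InnerProductSpace ℂ V]
    [Module (KLQuotient t n) V] [IsScalarTower ℂ (KLQuotient t n) V] : Prop where
  finiteDimensional : FiniteDimensional ℂ V
  selfAdjoint : ∀ (i : Fin (n - 1)) (x y : V),
    inner ℂ (KLQuotient.e t n i • x) y = inner ℂ x (KLQuotient.e t n i • y)
  decomposition : ∃ (r : ℕ) (W : Fin r → Submodule (KLQuotient t n) V),
    DirectSum.IsInternal W ∧
    (∀ j, IsSimpleModule (KLQuotient t n) (W j)) ∧
    (∀ j j', Nonempty (W j ≃ₗ[KLQuotient t n] W j') → j = j') ∧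
    (∀ (S : Type) [AddCommGroup S] [Module (KLQuotient t n) S],
      IsSimpleModule (KLQuotient t n) S → ∃ j, Nonempty (S ≃ₗ[KLQuotient t n] W j))

/-- The representation `𝓗_n(k,ℓ) → End(V)` given by a module structure on `V`. -/
noncomputable def klRep {k ℓ : ℕ} (t : MarkovTrace (rootParam ℓ) (etaParam k ℓ)) (n : ℕ)
    (V : Type*) [NormedAddCommGroup V] [InnerProductSpace ℂ V]
    [Module (KLQuotient t n) V] [IsScalarTower ℂ (KLQuotient t n) V] :
    KLQuotient t n →ₐ[ℂ] Module.End ℂ V :=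
  Algebra.lsmul ℂ ℂ V

/-- The representation `𝓑_n → GL(V)` induced by a representation of `𝓗_n(k,ℓ)` on `V` through
`σ_i ↦ g_i`. -/
noncomputable def braidRep {k ℓ : ℕ} (t : MarkovTrace (rootParam ℓ) (etaParam k ℓ)) (n : ℕ)
    (V : Type*) [NormedAddCommGroup V] [InnerProductSpace ℂ V]
    [Module (KLQuotient t n) V] [IsScalarTower ℂ (KLQuotient t n) V] :
    BraidGroup n →* (Module.End ℂ V)ˣ :=
  (Units.map (klRep t n V : KLQuotient t n →* Module.End ℂ V)).comp (KLQuotient.ofBraid t n)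

/-! At `q = e^{πi/3}` the Hecke algebra has the Goldschmidt–Jones model. Take letters u_i, v_i of
square -1, where the u's commute, the v's commute, and u_i, v_j anticommute exactly when |i - j| ≤
1. Then g_i = (q²/2)(1 + u_i + v_i + u_i v_i) satisfies the Hecke relations (`gjRep`). The algebra
of the u's and v's is a twisted group algebra of an elementary abelian 2-group, and the coefficient
of the identity is a trace on it (`Twisted.state_mul_comm`). Since e_m is 1/2 plus translations
involving the new index m, this trace is Markov with η = 1/2. Conversely H_{m+1} = H_m + H_m g_m H_m
(`mem_heckeStep`) forces uniqueness, so any Markov trace can be computed in the model.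

In the model the e_i are self-adjoint and the vacuum is separating. Hence the trace form is definite
on the image, and its annihilator is the kernel of `gjRep`. So H_n(3,6) acts faithfully on a
finite-dimensional Hilbert space with self-adjoint generators; it is semisimple, and one simple
submodule from each isotypic component gives a Jones–Wenzl representation. In any such
representation every simple left ideal occurs up to isomorphism, which gives faithfulness. Unitarity
holds because e_i acts as an orthogonal projection and the eigenvalues q, -1 of g_i have modulus 1.

For finiteness, conjugation by g_i permutes the finite set of signed translations
(`gjGen_conj_mem_gjSigned`), and these span an algebra containing the braid image. A braid acting
trivially on them is central in the image, so the centre has finite index. By Schur's theorem the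
commutator subgroup is finite, and the abelianization is finite because g_i^6 = 1. The image in
H_n(3,6) is this same finite group, and every φ_n factors through it. -/

/-! ### Central-by-finite groups -/

/-- A group with centre of finite index that is generated by finitely many elements of finite
order is finite. -/
theorem Group.finite_of_finiteIndex_center {G : Type*} [Group G] [(Subgroup.center G).FiniteIndex]
    {S : Set G} (hS : S.Finite) (hgen : Subgroup.closure S = ⊤) (hfin : ∀ s ∈ S, IsOfFinOrder s) :
    Finite G := by
  have hcomm : Finite (commutatorSet G) := by
    have : Finite (G ⧸ Subgroup.center G) := inferInstance
    -- A commutator depends only on the classes of its entries modulo the centre, so there are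
    -- finitely many; Schur's theorem then makes the commutator subgroup finite.
    let F : (G ⧸ Subgroup.center G) × (G ⧸ Subgroup.center G) → G :=
      fun p => p.1.out * p.2.out * p.1.out⁻¹ * p.2.out⁻¹
    refine Set.Finite.subset (Set.finite_range F) ?_
    rintro _ ⟨a, b, rfl⟩
    refine ⟨(a, b), ?_⟩
    obtain ⟨z, hz⟩ := QuotientGroup.mk_out_eq_mul (Subgroup.center G) a
    obtain ⟨w, hw⟩ := QuotientGroup.mk_out_eq_mul (Subgroup.center G) b
    simp only [F, hz, hw]
    have hzc := Subgroup.mem_center_iff.1 z.2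
    have hwc := Subgroup.mem_center_iff.1 w.2
    simp only [mul_inv_rev]
    calc a * z * (b * w) * ((z : G)⁻¹ * a⁻¹) * ((w : G)⁻¹ * b⁻¹)
        = a * (z * (b * w)) * ((z : G)⁻¹ * a⁻¹) * ((w : G)⁻¹ * b⁻¹) := by group
      _ = a * b * (w * a⁻¹) * ((w : G)⁻¹ * b⁻¹) := by rw [← hzc]; group
      _ = a * b * a⁻¹ * b⁻¹ := by rw [← hwc]; group
  have hab : Finite (Abelianization G) := by
    have hgen' : Subgroup.closure (Abelianization.of '' S) = ⊤ := by
      rw [← MonoidHom.map_closure, hgen, ← MonoidHom.range_eq_map, MonoidHom.range_eq_top]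
      exact QuotientGroup.mk_surjective
    have hfg : Group.FG (Abelianization G) :=
      Group.fg_iff.2 ⟨_, hgen', hS.image _⟩
    refine CommGroup.finite_of_fg_isMulTorsion _ ?_
    have : CommGroup.torsion (Abelianization G) = ⊤ := by
      rw [eq_top_iff, ← hgen', Subgroup.closure_le]
      rintro _ ⟨s, hs, rfl⟩
      exact MonoidHom.isOfFinOrder _ (hfin s hs)
    intro x
    have hx : x ∈ CommGroup.torsion (Abelianization G) := this ▸ Subgroup.mem_top x
    exact hx
  have : Finite (G ⧸ commutator G) := hab
  exact Finite.of_subgroup_quotient (commutator G)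

/-! ### Semisimple modules from self-adjoint generators, and multiplicity-free submodules -/

section SelfAdjointGenerators

variable {R : Type} [Ring R] [Algebra ℂ R] {K : Type*} [NormedAddCommGroup K]
  [InnerProductSpace ℂ K] {S : Set R}

/-- The elements with an adjoint in the image of `R` form a subalgebra: scalars are conjugated and
products reversed. An adjoint coming from `R` itself is what makes the orthogonal complement of a
submodule a submodule. -/
theorem exists_adjoint_of_adjoin_eq_top (φ : R →ₐ[ℂ] Module.End ℂ K)
    (hS : Algebra.adjoin ℂ S = ⊤) (hsa : ∀ s ∈ S, (φ s).IsSymmetric) (r : R) :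
    ∃ r' : R, ∀ x y, inner ℂ (φ r x) y = inner ℂ x (φ r' y) := by
  have hr : r ∈ Algebra.adjoin ℂ S := hS ▸ Algebra.mem_top
  induction hr using Algebra.adjoin_induction with
  | mem s hs => exact ⟨s, hsa s hs⟩
  | algebraMap c =>
    refine ⟨algebraMap ℂ R (starRingEnd ℂ c), fun x y => ?_⟩
    simp [Algebra.algebraMap_eq_smul_one, mul_comm]
  | add a b _ _ ha hb =>
    obtain ⟨a', ha⟩ := ha
    obtain ⟨b', hb⟩ := hb
    exact ⟨a' + b', fun x y => by
      simp only [map_add, LinearMap.add_apply, inner_add_left, inner_add_right, ha, hb]⟩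
  | mul a b _ _ ha hb =>
    obtain ⟨a', ha⟩ := ha
    obtain ⟨b', hb⟩ := hb
    exact ⟨b' * a', fun x y => by simp [ha, hb]⟩

variable [FiniteDimensional ℂ K] [Module R K] [IsScalarTower ℂ R K]

theorem isSemisimpleModule_of_selfAdjoint_generators (hS : Algebra.adjoin ℂ S = ⊤)
    (hsa : ∀ s ∈ S, (Algebra.lsmul ℂ ℂ K s).IsSymmetric) : IsSemisimpleModule R K := by
  rw [isSemisimpleModule_iff]
  refine ⟨fun p => ?_⟩
  let p' : Submodule ℂ K := p.restrictScalars ℂ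
  have hq : ∀ (r : R) (x : K), x ∈ p'ᗮ → r • x ∈ p'ᗮ := by
    intro r x hx
    obtain ⟨r', hr⟩ := exists_adjoint_of_adjoin_eq_top (Algebra.lsmul ℂ ℂ K) hS hsa r
    rw [Submodule.mem_orthogonal'] at hx ⊢
    intro u hu
    exact (hr x u).trans (hx _ (p.smul_mem r' hu))
  let o : Submodule R K := { p'ᗮ with smul_mem' := fun r x hx => hq r x hx }
  have hc : IsCompl p' p'ᗮ := Submodule.isCompl_orthogonal p'
  refine ⟨o, ?_, ?_⟩
  · rw [Submodule.disjoint_def]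
    exact fun x hx hx' => (Submodule.disjoint_def.1 hc.disjoint) x hx hx'
  · rw [codisjoint_iff, eq_top_iff]
    intro x _
    have hx : x ∈ p' ⊔ p'ᗮ := hc.sup_eq_top ▸ Submodule.mem_top
    obtain ⟨y, hy, z, hz, rfl⟩ := Submodule.mem_sup.1 hx
    exact Submodule.add_mem_sup (S := p) (T := o) hy hz

end SelfAdjointGenerators

/-- Acting on a ℂ-basis of `K` embeds `R`, as a left module, into a finite power of `K`. -/
theorem isSemisimpleRing_of_faithful_module (R K : Type*) [Ring R] [Algebra ℂ R] [AddCommGroup K]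
    [Module ℂ K] [FiniteDimensional ℂ K] [Module R K] [IsScalarTower ℂ R K]
    [FaithfulSMul R K] [IsSemisimpleModule R K] : IsSemisimpleRing R := by
  let b := Module.finBasis ℂ K
  let f : R →ₗ[R] (Fin (Module.finrank ℂ K) → K) :=
    LinearMap.pi fun i => LinearMap.toSpanSingleton R K (b i)
  refine IsSemisimpleModule.of_injective f ?_
  intro r r' h
  have : Algebra.lsmul ℂ ℂ K r = Algebra.lsmul ℂ ℂ K r' :=
    b.ext fun i => by simpa [f] using congrFun h i
  exact FaithfulSMul.eq_of_smul_eq_smul fun x => LinearMap.congr_fun this x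

/-- A faithful semisimple module over a semisimple ring contains a copy of every simple module. -/
theorem exists_simple_submodule_of_faithful (R K S : Type*) [Ring R] [AddCommGroup K] [Module R K]
    [FaithfulSMul R K] [IsSemisimpleRing R] [AddCommGroup S] [Module R S] [IsSimpleModule R S] :
    ∃ T : Submodule R K, Nonempty (S ≃ₗ[R] T) := by
  obtain ⟨J, ⟨f⟩⟩ := IsSemisimpleRing.exists_linearEquiv_ideal_of_isSimpleModule R S
  have hJ : IsSimpleModule R J := IsSimpleModule.congr f.symm
  have hne : Nontrivial J := IsSimpleModule.nontrivial R J
  obtain ⟨j, hj⟩ := exists_ne (0 : J)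
  obtain ⟨k, hk⟩ : ∃ k : K, (j : R) • k ≠ 0 := by
    by_contra! h
    refine hj (Subtype.ext ?_)
    exact FaithfulSMul.eq_of_smul_eq_smul (α := K) fun x => by simp [h x]
  -- Evaluation at a vector not killed by `j` is a nonzero map out of a simple module, hence
  -- injective.
  let F : J →ₗ[R] K := (LinearMap.toSpanSingleton R K k).comp J.subtype
  have hF : Function.Injective F := by
    refine F.injective_or_eq_zero.resolve_right fun h => hk ?_
    simpa [F] using LinearMap.congr_fun h j
  exact ⟨_, ⟨f.trans (LinearEquiv.ofInjective F hF)⟩⟩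

/-- A noetherian module has a submodule that is the internal direct sum of simple modules, one from
each isomorphism class of simple submodules. -/
theorem exists_multiplicityFree_submodule (R K : Type*) [Ring R] [AddCommGroup K] [Module R K]
    [IsNoetherian R K] :
    ∃ (V : Submodule R K) (r : ℕ) (W : Fin r → Submodule R V), DirectSum.IsInternal W ∧
      (∀ j, IsSimpleModule R (W j)) ∧
      (∀ j j', Nonempty (W j ≃ₗ[R] W j') → j = j') ∧
      ∀ T : Submodule R K, IsSimpleModule R T → ∃ j, Nonempty (T ≃ₗ[R] W j) := by
  classical
  -- One simple submodule is picked in each isotypic component. Independence is inherited from the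
  -- components, and noetherianity makes them finite in number.
  choose A hA hcA using fun c : isotypicComponents R K => c.2
  let e := Finite.equivFin (isotypicComponents R K)
  let B : Fin (Nat.card (isotypicComponents R K)) → Submodule R K := fun j => A (e.symm j)
  have hind : iSupIndep B := by
    refine (((sSupIndep_iff _).1 (sSupIndep_isotypicComponents R K)).mono fun c => ?_).comp
      e.symm.injective
    exact (A c).le_isotypicComponent.trans_eq (hcA c).symm
  have hle : ∀ j, B j ≤ ⨆ i, B i := le_iSup B
  have hequiv : ∀ j, Nonempty ((B j).comap (⨆ i, B i).subtype ≃ₗ[R] B j) :=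
    fun j => ⟨Submodule.comapSubtypeEquivOfLe (hle j)⟩
  refine ⟨⨆ i, B i, _, fun j => (B j).comap (⨆ i, B i).subtype, ?_, ?_, ?_, ?_⟩
  · refine (DirectSum.isInternal_submodule_iff_iSupIndep_and_iSup_eq_top _).2 ⟨?_, ?_⟩
    swap
    · apply Submodule.map_injective_of_injective (Submodule.subtype_injective _)
      simp only [Submodule.map_iSup, Submodule.map_comap_subtype, inf_of_le_right (hle _),
        Submodule.map_top, Submodule.range_subtype]
    let f : Submodule R (⨆ i, B i : Submodule R K) ≃o Set.Iic (⨆ i, B i) := (⨆ i, B i).mapIic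
    suffices (f ∘ fun i => (B i).comap (⨆ i, B i).subtype) = fun i => ⟨B i, hle i⟩ by
      rw [← iSupIndep_map_orderIso_iff f, this]
      exact .of_coe_Iic_comp hind
    ext i m
    change m ∈ ((B i).comap (⨆ i, B i).subtype).map (⨆ i, B i).subtype ↔ _
    rw [Submodule.map_comap_subtype, inf_of_le_right (hle i)]
  · intro j
    obtain ⟨f⟩ := hequiv j
    have := hA (e.symm j)
    exact IsSimpleModule.congr f
  · rintro j j' ⟨f⟩
    obtain ⟨f₁⟩ := hequiv j
    obtain ⟨f₂⟩ := hequiv j'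
    apply e.symm.injective
    apply Subtype.ext
    rw [hcA, hcA (e.symm j')]
    exact ((f₁.symm.trans f).trans f₂).isotypicComponent_eq
  · intro T hT
    obtain ⟨j, hj⟩ := e.symm.surjective ⟨isotypicComponent R K T, T, hT, rfl⟩
    refine ⟨j, ?_⟩
    obtain ⟨f⟩ := hequiv j
    have hc : isotypicComponent R K T = isotypicComponent R K (B j) :=
      (congrArg Subtype.val hj).symm.trans (hcA (e.symm j))
    have := hA (e.symm j)
    have hT' : T ≤ isotypicComponent R K (B j) :=
      T.le_isotypicComponent.trans_eq hc
    obtain ⟨g⟩ := isIsotypicOfType_submodule_iff.1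
      (IsIsotypicOfType.isotypicComponent R K (B j)) T hT'
    exact ⟨g.trans f.symm⟩

/-! ### Twisted group algebras of elementary abelian 2-groups -/

/-- The sign `(-1)^z`. -/
noncomputable def zmodSign (z : ZMod 2) : ℂ := if z = 0 then 1 else -1

theorem zmodSign_zero : zmodSign 0 = 1 := by simp [zmodSign]

theorem zmodSign_one : zmodSign 1 = -1 := by simp [zmodSign]

theorem zmodSign_add (a b : ZMod 2) : zmodSign (a + b) = zmodSign a * zmodSign b := by
  have h : ∀ z : ZMod 2, z = 0 ∨ z = 1 := by decide
  rcases h a with rfl | rfl <;> rcases h b with rfl | rfl <;>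
    simp [zmodSign_zero, zmodSign_one, CharTwo.add_self_eq_zero]

theorem zmodSign_mul_self (a : ZMod 2) : zmodSign a * zmodSign a = 1 := by
  rw [← zmodSign_add, ZModModule.add_self, zmodSign_zero]

theorem zmodSign_eq (a : ZMod 2) : zmodSign a = 1 ∨ zmodSign a = -1 := by
  unfold zmodSign; split_ifs <;> simp

theorem star_zmodSign (a : ZMod 2) : star (zmodSign a) = zmodSign a := by
  rcases zmodSign_eq a with h | h <;> simp [h]

namespace Twisted

variable {J : Type*} (c : J → J → ZMod 2)

/-- The bilinear form on the free `ZMod 2`-module on `J` with matrix `c`. -/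
noncomputable def form : (J →₀ ZMod 2) →ₗ[ZMod 2] (J →₀ ZMod 2) →ₗ[ZMod 2] ZMod 2 :=
  Finsupp.linearCombination (ZMod 2) fun i => Finsupp.linearCombination (ZMod 2) (c i)

@[simp]
theorem form_single (i j : J) : form c (.single i 1) (.single j 1) = c i j := by
  simp [form]

/-- Left translation by `x`, twisted by the cocycle `(-1)^form`. -/
noncomputable def left (x : J →₀ ZMod 2) : Module.End ℂ ((J →₀ ZMod 2) → ℂ) where
  toFun f y := zmodSign (form c x (y + x)) * f (y + x)
  map_add' f g := by ext y; simp [mul_add]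
  map_smul' r f := by ext y; simp [mul_left_comm]

/-- Right translation by `x`, twisted by the cocycle `(-1)^form`. -/
noncomputable def right (x : J →₀ ZMod 2) : Module.End ℂ ((J →₀ ZMod 2) → ℂ) where
  toFun f y := zmodSign (form c (y + x) x) * f (y + x)
  map_add' f g := by ext y; simp [mul_add]
  map_smul' r f := by ext y; simp [mul_left_comm]

theorem left_apply (x : J →₀ ZMod 2) (f : (J →₀ ZMod 2) → ℂ) (y : J →₀ ZMod 2) :
    left c x f y = zmodSign (form c x (y + x)) * f (y + x) := rfl

theorem right_apply (x : J →₀ ZMod 2) (f : (J →₀ ZMod 2) → ℂ) (y : J →₀ ZMod 2) :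
    right c x f y = zmodSign (form c (y + x) x) * f (y + x) := rfl

/-- Bilinearity of the form is the cocycle identity. The two sides differ by the square of the sign
of `form c x y`. -/
theorem left_mul_left (x y : J →₀ ZMod 2) :
    left c x * left c y = zmodSign (form c x y) • left c (x + y) := by
  ext f z
  simp only [Module.End.mul_apply, LinearMap.smul_apply, Pi.smul_apply, smul_eq_mul, left_apply,
    map_add, LinearMap.add_apply, zmodSign_add, ← add_assoc]
  linear_combination (-zmodSign (form c x z) * zmodSign (form c x x) * zmodSign (form c y z) *
    zmodSign (form c y x) * zmodSign (form c y y) * f (z + x + y)) *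
    zmodSign_mul_self (form c x y)

theorem left_zero : left c 0 = 1 := by
  ext f z
  simp [left_apply, zmodSign_zero]

theorem left_mul_self (x : J →₀ ZMod 2) :
    left c x * left c x = algebraMap ℂ _ (zmodSign (form c x x)) := by
  rw [left_mul_left, ZModModule.add_self, left_zero, Algebra.algebraMap_eq_smul_one]

theorem left_mul_comm (x y : J →₀ ZMod 2) :
    left c x * left c y = zmodSign (form c x y + form c y x) • (left c y * left c x) := by
  rw [left_mul_left, left_mul_left, smul_smul, zmodSign_add, mul_assoc, zmodSign_mul_self, mul_one,
    add_comm y x]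

theorem left_mul_right (x y : J →₀ ZMod 2) :
    left c x * right c y = right c y * left c x := by
  ext f z
  simp only [Module.End.mul_apply, left_apply, right_apply, map_add, LinearMap.add_apply,
    zmodSign_add, add_right_comm z x y]
  ring

open Classical in
/-- The delta function at `0`. -/
noncomputable def vac : (J →₀ ZMod 2) → ℂ := Pi.single 0 1

theorem vac_zero : (vac : (J →₀ ZMod 2) → ℂ) 0 = 1 := by simp [vac]

theorem vac_of_ne {x : J →₀ ZMod 2} (h : x ≠ 0) : (vac : (J →₀ ZMod 2) → ℂ) x = 0 := by
  simp [vac, h]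

/-- Both sides are supported at `x`, where the form is evaluated with an argument 0 and the sign is
trivial. -/
theorem left_vac (x : J →₀ ZMod 2) : left c x vac = right c x vac := by
  ext y
  rw [left_apply, right_apply]
  by_cases h : y + x = 0
  · simp [h]
  · simp [vac_of_ne h]

theorem left_apply_zero (x : J →₀ ZMod 2) (f : (J →₀ ZMod 2) → ℂ) :
    left c x f 0 = right c x f 0 := by
  simp [left_apply, right_apply]

/-- The vacuum state. -/
noncomputable def state : Module.End ℂ ((J →₀ ZMod 2) → ℂ) →ₗ[ℂ] ℂ where
  toFun T := T vac 0
  map_add' _ _ := rfl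
  map_smul' _ _ := rfl

theorem state_apply (T : Module.End ℂ ((J →₀ ZMod 2) → ℂ)) : state T = T vac 0 := rfl

theorem state_one : state (1 : Module.End ℂ ((J →₀ ZMod 2) → ℂ)) = 1 := by
  rw [state_apply, Module.End.one_apply, vac_zero]

/-- The algebra generated by all twisted left translations. -/
noncomputable def leftAlg : Subalgebra ℂ (Module.End ℂ ((J →₀ ZMod 2) → ℂ)) :=
  Algebra.adjoin ℂ (Set.range (left c))

theorem left_mem_leftAlg (x : J →₀ ZMod 2) : left c x ∈ leftAlg c :=
  Algebra.subset_adjoin ⟨x, rfl⟩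

theorem mul_right_of_mem_leftAlg {T : Module.End ℂ ((J →₀ ZMod 2) → ℂ)} (hT : T ∈ leftAlg c)
    (x : J →₀ ZMod 2) : T * right c x = right c x * T := by
  have h : leftAlg c ≤ Subalgebra.centralizer ℂ {right c x} := by
    refine Algebra.adjoin_le ?_
    rintro _ ⟨y, rfl⟩
    rw [SetLike.mem_coe, Subalgebra.mem_centralizer_iff]
    rintro _ rfl
    exact (left_mul_right c y x).symm
  exact ((Subalgebra.mem_centralizer_iff ℂ).1 (h hT) _ rfl).symm

theorem state_mul_left {T : Module.End ℂ ((J →₀ ZMod 2) → ℂ)} (hT : T ∈ leftAlg c)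
    (x : J →₀ ZMod 2) : state (T * left c x) = right c x (T vac) 0 := by
  rw [state_apply, Module.End.mul_apply, left_vac, ← Module.End.mul_apply,
    mul_right_of_mem_leftAlg c hT, Module.End.mul_apply]

/-- A left translation next to the vacuum may be replaced by the right one, commuted past the left
algebra, and turned back into a left one under evaluation at 0. The general case follows by
induction on `T`. -/
theorem state_mul_comm {S T : Module.End ℂ ((J →₀ ZMod 2) → ℂ)} (hS : S ∈ leftAlg c)
    (hT : T ∈ leftAlg c) : state (S * T) = state (T * S) := by
  have hT' : T ∈ Algebra.adjoin ℂ (Set.range (left c)) := hT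
  induction hT' using Algebra.adjoin_induction generalizing S with
  | mem _ h =>
    obtain ⟨x, rfl⟩ := h
    rw [state_mul_left c hS, state_apply, Module.End.mul_apply, left_apply_zero]
  | algebraMap r => rw [Algebra.commutes]
  | add a b ha hb ha' hb' => simp only [mul_add, add_mul, map_add, ha' hS ha, hb' hS hb]
  | mul a b ha hb ha' hb' =>
    rw [← mul_assoc, hb' (mul_mem hS ha) hb, ← mul_assoc, ha' (mul_mem hb hS) ha, mul_assoc]

/-- Operators generated by translations in a subgroup `H` are orthogonal to the translations outside
of `H`. -/
theorem state_mul_left_eq_zero (H : AddSubgroup (J →₀ ZMod 2))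
    {T : Module.End ℂ ((J →₀ ZMod 2) → ℂ)} (hT : T ∈ Algebra.adjoin ℂ (left c '' H))
    {x : J →₀ ZMod 2} (hx : x ∉ H) : state (T * left c x) = 0 := by
  have hT' : T ∈ leftAlg c := Algebra.adjoin_mono (Set.image_subset_range _ _) hT
  -- `T` preserves the functions supported on `H`, the vacuum among them, while the state in
  -- question is, up to sign, the value of `T vac` at `x`.
  have key : ∀ f : (J →₀ ZMod 2) → ℂ, (∀ y ∉ H, f y = 0) → ∀ y ∉ H, T f y = 0 := by
    clear hT'
    induction hT using Algebra.adjoin_induction with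
    | mem _ h =>
      obtain ⟨z, hz, rfl⟩ := h
      intro f hf y hy
      rw [left_apply, hf _ fun h => hy (by simpa using sub_mem h hz), mul_zero]
    | algebraMap r =>
      intro f hf y hy
      simp [Algebra.algebraMap_eq_smul_one, hf y hy]
    | add a b _ _ ha hb =>
      intro f hf y hy
      simp [ha f hf y hy, hb f hf y hy]
    | mul a b _ _ ha hb =>
      intro f hf y hy
      exact ha _ (hb f hf) y hy
  rw [state_mul_left c hT', right_apply, zero_add,
    key vac (fun y hy => vac_of_ne fun h => hy (h ▸ H.zero_mem)) x hx, mul_zero]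

/-- The vacuum is a separating vector. -/
theorem eq_zero_of_apply_vac [Finite J] {T : Module.End ℂ ((J →₀ ZMod 2) → ℂ)} (hT : T ∈ leftAlg c)
    (h : T vac = 0) : T = 0 := by
  classical
  have : Finite (J →₀ ZMod 2) := Finite.of_injective _ DFunLike.coe_injective
  refine LinearMap.pi_ext' fun x => LinearMap.ext_ring ?_
  -- The right translates of the vacuum are the delta functions, and `T` commutes with right
  -- translations, so `T vac` determines `T`.
  have : right c x vac = Pi.single x 1 := by
    ext y
    by_cases hy : y = x
    · subst hy
      simp [right_apply, ZModModule.add_self, vac_zero, zmodSign_zero]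
    · have hne : y + x ≠ 0 := fun h => hy (by
        rw [← ZModModule.add_self x] at h; exact add_right_cancel h)
      simp [right_apply, vac_of_ne hne, hy]
  simp only [LinearMap.comp_apply, LinearMap.coe_single, LinearMap.zero_comp, LinearMap.zero_apply]
  rw [← this, ← Module.End.mul_apply, mul_right_of_mem_leftAlg c hT, Module.End.mul_apply, h,
    map_zero]

theorem sum_star_left_mul [Fintype (J →₀ ZMod 2)] (x : J →₀ ZMod 2)
    (f g : (J →₀ ZMod 2) → ℂ) :
    ∑ y, star (left c x f y) * g y =
      ∑ y, star (f y) * (zmodSign (form c x x) • left c x) g y := by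
  refine Fintype.sum_equiv (Equiv.addRight x) _ _ fun y => ?_
  simp only [left_apply, Equiv.coe_addRight, LinearMap.smul_apply, Pi.smul_apply, smul_eq_mul,
    add_assoc, ZModModule.add_self, add_zero, map_add, star_mul', star_zmodSign, zmodSign_add]
  ring

section Restriction

variable {J' : Type*} (c' : J' → J' → ZMod 2) (ι : J → J')

/-- Restriction of functions along a map of index types. -/
noncomputable def restrict : ((J' →₀ ZMod 2) → ℂ) →ₗ[ℂ] ((J →₀ ZMod 2) → ℂ) :=
  LinearMap.funLeft ℂ ℂ (Finsupp.mapDomain ι)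

theorem restrict_apply (f : (J' →₀ ZMod 2) → ℂ) (x : J →₀ ZMod 2) :
    restrict ι f x = f (x.mapDomain ι) := rfl

variable {ι} in
theorem restrict_vac (hι : Function.Injective ι) : restrict ι vac = vac := by
  ext x
  rw [restrict_apply]
  by_cases h : x = 0
  · subst h; simp [vac_zero]
  · rw [vac_of_ne h, vac_of_ne]
    exact fun h' => h (Finsupp.mapDomain_injective hι (by rw [h', Finsupp.mapDomain_zero]))

variable {c c' ι} in
theorem restrict_left (hc : ∀ i j, c i j = c' (ι i) (ι j)) (x : J →₀ ZMod 2)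
    (f : (J' →₀ ZMod 2) → ℂ) :
    restrict ι (left c' (x.mapDomain ι) f) = left c x (restrict ι f) := by
  have hform : ∀ x y, form c' (x.mapDomain ι) (y.mapDomain ι) = form c x y := by
    have : (form c').compl₁₂ (Finsupp.lmapDomain (ZMod 2) (ZMod 2) ι)
        (Finsupp.lmapDomain (ZMod 2) (ZMod 2) ι) = form c := by
      ext i j
      simp [hc]
    exact fun x y => LinearMap.congr_fun₂ this x y
  ext y
  simp only [restrict_apply, left_apply, ← Finsupp.mapDomain_add, hform]

end Restriction

end Twisted

/-! ### Hecke relations for quaternionic pairs -/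

section Quaternion

variable {A : Type*} [Ring A] [Algebra ℂ A] (q : ℂ)

/-- The Goldschmidt–Jones element attached to a quaternionic pair `u`, `v`. -/
noncomputable def goldschmidtJones (u v : A) : A := (q ^ 2 / 2) • (1 + u + v + u * v)

variable {q}

/-- The elements u, v, uv anticommute pairwise and have square -1, so s = u + v + uv satisfies s² =
-3. Hence (1 + s)/2 is a root of x² - x + 1, whose roots are q and q⁻¹; multiplying by q² turns
these into -1 and q. -/
theorem goldschmidtJones_quad (hq : q ^ 2 = q - 1) {u v : A} (hu : u * u = -1) (hv : v * v = -1)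
    (huv : v * u = -(u * v)) :
    (goldschmidtJones q u v + 1) * (goldschmidtJones q u v - algebraMap ℂ A q) = 0 := by
  have h1 : ∀ x, u * (u * x) = -x := fun x => by rw [← mul_assoc, hu, neg_one_mul]
  have h3 : ∀ x, v * (u * x) = -(u * (v * x)) := fun x => by
    rw [← mul_assoc, huv, neg_mul, mul_assoc]
  have hq4 : q ^ 4 = -q := by linear_combination (q ^ 2 + q) * hq
  simp only [goldschmidtJones, Algebra.algebraMap_eq_smul_one, mul_add, add_mul, mul_sub,
    mul_one, one_mul, smul_mul_assoc, mul_smul_comm, smul_smul, mul_assoc, hu, hv, huv, h1, h3,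
    mul_neg, neg_neg, smul_add, smul_neg]
  match_scalars
  · linear_combination (1 / 2 * q ^ 2) * hq - hq4
  all_goals linear_combination (1 / 2 * q ^ 2) * hq

theorem goldschmidtJones_comm {u₁ v₁ u₂ v₂ : A} (huu : u₂ * u₁ = u₁ * u₂)
    (hvv : v₂ * v₁ = v₁ * v₂) (huv : u₂ * v₁ = v₁ * u₂) (hvu : v₂ * u₁ = u₁ * v₂) :
    goldschmidtJones q u₁ v₁ * goldschmidtJones q u₂ v₂ =
      goldschmidtJones q u₂ v₂ * goldschmidtJones q u₁ v₁ := by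
  have hu : Commute u₁ u₂ := huu.symm
  have hv : Commute v₁ v₂ := hvv.symm
  have hx : Commute v₁ u₂ := huv.symm
  have hy : Commute u₁ v₂ := hvu.symm
  have h1 : ∀ x : A, Commute x u₂ → Commute x v₂ → Commute x (1 + u₂ + v₂ + u₂ * v₂) :=
    fun x h h' => (((Commute.one_right x).add_right h).add_right h').add_right (h.mul_right h')
  have h2 := h1 u₁ hu hy
  have h3 := h1 v₁ hx hv
  exact (((((Commute.one_left _).add_left h2).add_left h3).add_left
    (h2.mul_left h3)).smul_left _).smul_right _

theorem goldschmidtJones_braid {u₁ v₁ u₂ v₂ : A} (hu₁ : u₁ * u₁ = -1) (hv₁ : v₁ * v₁ = -1)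
    (huv₁ : v₁ * u₁ = -(u₁ * v₁)) (hu₂ : u₂ * u₂ = -1) (hv₂ : v₂ * v₂ = -1)
    (huv₂ : v₂ * u₂ = -(u₂ * v₂)) (huu : u₂ * u₁ = u₁ * u₂)
    (hvv : v₂ * v₁ = v₁ * v₂) (huv : v₁ * u₂ = -(u₂ * v₁)) (hvu : v₂ * u₁ = -(u₁ * v₂)) :
    goldschmidtJones q u₁ v₁ * goldschmidtJones q u₂ v₂ * goldschmidtJones q u₁ v₁ =
      goldschmidtJones q u₂ v₂ * goldschmidtJones q u₁ v₁ * goldschmidtJones q u₂ v₂ := by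
  have aux : ∀ {a b c : A}, a * b = c → ∀ x, a * (b * x) = c * x := fun h x => by
    rw [← mul_assoc, h]
  simp only [goldschmidtJones, smul_mul_assoc, mul_smul_comm, smul_smul]
  congr 1
  -- The relations are oriented towards the normal form u₁ u₂ v₁ v₂, so the 64 words on each side
  -- become signed normal monomials.
  simp only [mul_add, add_mul, mul_one, one_mul, mul_assoc, hu₁, hv₁, huv₁, hu₂, hv₂, huv₂, huu,
    hvv, huv, hvu, aux hu₁, aux hv₁, aux huv₁, aux hu₂, aux huv₂, aux huu,
    aux huv, aux hvu, mul_neg, neg_mul, neg_neg]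
  abel

end Quaternion

/-! ### The values of q and η -/

section Parameters

theorem rootParam_six : rootParam 6 = 1 / 2 + Real.sqrt 3 / 2 * Complex.I := by
  rw [rootParam, show (2 * Real.pi * Complex.I / (6 : ℕ) : ℂ) = (Real.pi / 3 : ℝ) * Complex.I by
    push_cast; ring, Complex.exp_mul_I, ← Complex.ofReal_cos, ← Complex.ofReal_sin,
    Real.cos_pi_div_three, Real.sin_pi_div_three]
  push_cast
  ring

theorem rootParam_six_sq : rootParam 6 ^ 2 = rootParam 6 - 1 := by
  have h3 : ((Real.sqrt 3 : ℝ) : ℂ) ^ 2 = 3 := by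
    rw [← Complex.ofReal_pow, Real.sq_sqrt (by norm_num)]; norm_num
  rw [rootParam_six]
  linear_combination (1 / 4 * Complex.I ^ 2) * h3 + (3 / 4) * Complex.I_sq

theorem star_rootParam_six : starRingEnd ℂ (rootParam 6) = 1 - rootParam 6 := by
  rw [rootParam_six]
  simp only [map_add, map_mul, map_div₀, map_one, map_ofNat, Complex.conj_ofReal, Complex.conj_I]
  ring

theorem one_add_rootParam_six_ne_zero : 1 + rootParam 6 ≠ 0 := by
  intro h
  have h' := rootParam_six_sq
  rw [show rootParam 6 = -1 by linear_combination h] at h'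
  norm_num at h'

theorem etaParam_three_six : etaParam 3 6 = 1 / 2 := by
  have h := rootParam_six_sq
  have h3 : rootParam 6 ^ 3 = -1 := by linear_combination (rootParam 6 + 1) * h
  have h1 := one_add_rootParam_six_ne_zero
  have h0 := rootParam_ne_zero 6
  rw [etaParam, h3, show (1 - ((3 : ℕ) : ℤ)) = -2 by norm_num, zpow_neg, zpow_ofNat,
    div_eq_div_iff]
  · field_simp
    linear_combination -2 * h3
  · simp only [ne_eq, mul_eq_zero, not_or]
    exact ⟨h1, by norm_num⟩
  · norm_num

end Parameters

/-! ### Universal property and generators of the Hecke algebra -/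

namespace HeckeAlg

section Lift

variable {I : Type} {pos : I → ℕ} {q : ℂ} {A : Type*} [Ring A] [Algebra ℂ A]

/-- The universal property of the Hecke algebra. -/
noncomputable def lift (s : I → A)
    (hbraid : ∀ i j, pos j = pos i + 1 → s i * s j * s i = s j * s i * s j)
    (hcomm : ∀ i j, pos i + 1 < pos j → s i * s j = s j * s i)
    (hquad : ∀ i, (s i + 1) * (s i - algebraMap ℂ A q) = 0) : HeckeAlg pos q →ₐ[ℂ] A :=
  RingQuot.liftAlgHom ℂ ⟨FreeAlgebra.lift ℂ s, by
    intro x y h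
    induction h with
    | braid i j h => simpa using hbraid i j h
    | comm i j h => simpa using hcomm i j h
    | quad i =>
      rw [map_mul, map_add, map_sub, map_one, map_zero, AlgHom.commutes, FreeAlgebra.lift_ι_apply]
      exact hquad i⟩

theorem lift_g (s : I → A) (hbraid hcomm hquad) (i : I) :
    lift (pos := pos) (q := q) s hbraid hcomm hquad (g pos q i) = s i := by
  have : lift (pos := pos) (q := q) s hbraid hcomm hquad (g pos q i) =
      FreeAlgebra.lift ℂ s (FreeAlgebra.ι ℂ i) := RingQuot.liftAlgHom_mkAlgHom_apply ..
  rw [this, FreeAlgebra.lift_ι_apply]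

end Lift

variable {I : Type} (pos : I → ℕ) (q : ℂ)

theorem ofFree_surjective : Function.Surjective (ofFree pos q) :=
  RingQuot.mkAlgHom_surjective ℂ (HeckeRel pos q)

theorem adjoin_range_g : Algebra.adjoin ℂ (Set.range (g pos q)) = ⊤ := by
  have : Set.range (g pos q) = ofFree pos q '' Set.range (FreeAlgebra.ι ℂ) := by
    rw [← Set.range_comp]; rfl
  rw [this, ← AlgHom.map_adjoin, FreeAlgebra.adjoin_range_ι, Algebra.map_top,
    AlgHom.range_eq_top]
  exact ofFree_surjective pos q

variable {q}

theorem g_eq (hq : 1 + q ≠ 0) (i : I) :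
    g pos q i = algebraMap ℂ _ q - (1 + q) • e pos q i := by
  rw [e, smul_smul, mul_inv_cancel₀ hq, one_smul, sub_sub_cancel]

theorem adjoin_range_e (hq : 1 + q ≠ 0) : Algebra.adjoin ℂ (Set.range (e pos q)) = ⊤ := by
  rw [eq_top_iff, ← adjoin_range_g pos q]
  refine Algebra.adjoin_le ?_
  rintro _ ⟨i, rfl⟩
  rw [g_eq pos hq i]
  exact sub_mem (Subalgebra.algebraMap_mem _ _)
    (Subalgebra.smul_mem _ (Algebra.subset_adjoin (Set.mem_range_self i)) _)

theorem e_mul_self (hq : 1 + q ≠ 0) (i : I) : e pos q i * e pos q i = e pos q i := by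
  have h := g_quad (pos := pos) (q := q) i
  have h1 : g pos q i + 1 = (1 + q) • (1 - e pos q i) := by
    rw [g_eq pos hq i, Algebra.algebraMap_eq_smul_one]; module
  have h2 : g pos q i - algebraMap ℂ _ q = -((1 + q) • e pos q i) := by
    rw [g_eq pos hq i]; abel
  rw [h1, h2, mul_neg, neg_eq_zero, smul_mul_assoc, mul_smul_comm, smul_eq_zero_iff_right hq,
    smul_eq_zero_iff_right hq, sub_mul, one_mul, sub_eq_zero] at h
  exact h.symm

theorem g_sq (i : I) : g pos q i * g pos q i = (q - 1) • g pos q i + algebraMap ℂ _ q := by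
  have h := g_quad (pos := pos) (q := q) i
  rw [Algebra.algebraMap_eq_smul_one] at h ⊢
  rw [← sub_eq_zero, ← h]
  simp only [add_mul, mul_sub, one_mul, mul_smul_comm, mul_one]
  module

end HeckeAlg

theorem heckeIncl_g (n : ℕ) (q : ℂ) (i : Fin (n - 1)) :
    heckeIncl n q (HeckeAlg.g _ q i) = HeckeAlg.g (fun i : ℕ => i) q i := by
  have : heckeIncl n q (HeckeAlg.g _ q i) = FreeAlgebra.lift ℂ
      (fun i : Fin (n - 1) => HeckeAlg.g (fun i : ℕ => i) q (i : ℕ)) (FreeAlgebra.ι ℂ i) :=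
    RingQuot.liftAlgHom_mkAlgHom_apply ..
  rw [this, FreeAlgebra.lift_ι_apply]

/-! ### The Goldschmidt–Jones representation -/

section Representation

/-- The cocycle of the Goldschmidt–Jones quaternionic algebra. -/
def gjCocycle (a b : ℕ × Bool) : ZMod 2 :=
  if a.2 = b.2 then (if a.1 = b.1 then 1 else 0)
  -- The sign is charged only to v before u. The symmetrized form, which governs commutation, is
  -- then 1 exactly for a u and a v at distance at most one.
  else if a.2 = true ∧ a.1 ≤ b.1 + 1 ∧ b.1 ≤ a.1 + 1 then 1 else 0

variable {I : Type} (pos : I → ℕ)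

/-- The cocycle `gjCocycle` on generators placed on the line by `pos`. -/
def gjForm (a b : I × Bool) : ZMod 2 := gjCocycle (pos a.1, a.2) (pos b.1, b.2)

/-- The `i`-th quaternionic pair: `u_i` for `false` and `v_i` for `true`. -/
noncomputable def gjUnit (a : I × Bool) : Module.End ℂ ((I × Bool →₀ ZMod 2) → ℂ) :=
  Twisted.left (gjForm pos) (.single a 1)

theorem gjUnit_mem (a : I × Bool) : gjUnit pos a ∈ Twisted.leftAlg (gjForm pos) :=
  Twisted.left_mem_leftAlg _ _

theorem gjUnit_mul_self (a : I × Bool) : gjUnit pos a * gjUnit pos a = -1 := by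
  rw [gjUnit, Twisted.left_mul_self, Twisted.form_single]
  simp [gjForm, gjCocycle, zmodSign_one]

theorem gjUnit_mul_comm (a b : I × Bool) : gjUnit pos a * gjUnit pos b =
    zmodSign (gjForm pos a b + gjForm pos b a) • (gjUnit pos b * gjUnit pos a) := by
  rw [gjUnit, gjUnit, Twisted.left_mul_comm, Twisted.form_single, Twisted.form_single]

theorem gjUnit_comm_same (i j : I) (b : Bool) :
    gjUnit pos (i, b) * gjUnit pos (j, b) = gjUnit pos (j, b) * gjUnit pos (i, b) := by
  have : gjForm pos (i, b) (j, b) = gjForm pos (j, b) (i, b) := by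
    simp [gjForm, gjCocycle, eq_comm]
  rw [gjUnit_mul_comm, this, ZModModule.add_self, zmodSign_zero, one_smul]

theorem gjUnit_anticomm {i j : I} (h : pos i ≤ pos j + 1 ∧ pos j ≤ pos i + 1) {b b' : Bool}
    (hb : b ≠ b') :
    gjUnit pos (i, b) * gjUnit pos (j, b') = -(gjUnit pos (j, b') * gjUnit pos (i, b)) := by
  have : gjForm pos (i, b) (j, b') + gjForm pos (j, b') (i, b) = 1 := by
    cases b <;> cases b' <;> simp_all [gjForm, gjCocycle]
  rw [gjUnit_mul_comm, this, zmodSign_one]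
  module

theorem gjUnit_comm_far {i j : I} (h : ¬(pos i ≤ pos j + 1 ∧ pos j ≤ pos i + 1)) {b b' : Bool}
    (hb : b ≠ b') :
    gjUnit pos (i, b) * gjUnit pos (j, b') = gjUnit pos (j, b') * gjUnit pos (i, b) := by
  have h' : ¬(pos j ≤ pos i + 1 ∧ pos i ≤ pos j + 1) := fun h₁ => h ⟨h₁.2, h₁.1⟩
  have : gjForm pos (i, b) (j, b') + gjForm pos (j, b') (i, b) = 0 := by
    cases b <;> cases b' <;> simp_all [gjForm, gjCocycle]
  rw [gjUnit_mul_comm, this, zmodSign_zero, one_smul]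

/-- The image of the generator `g_i` in the Goldschmidt–Jones algebra. -/
noncomputable def gjGen (i : I) : Module.End ℂ ((I × Bool →₀ ZMod 2) → ℂ) :=
  goldschmidtJones (rootParam 6) (gjUnit pos (i, false)) (gjUnit pos (i, true))

/-- The Goldschmidt–Jones representation of the Hecke algebra at `q = e^{2πi/6}`. -/
noncomputable def gjRep :
    HeckeAlg pos (rootParam 6) →ₐ[ℂ] Module.End ℂ ((I × Bool →₀ ZMod 2) → ℂ) :=
  HeckeAlg.lift (gjGen pos)
    (fun i j h => goldschmidtJones_braid (gjUnit_mul_self pos _) (gjUnit_mul_self pos _)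
      (gjUnit_anticomm pos ⟨by omega, by omega⟩ (by simp))
      (gjUnit_mul_self pos _) (gjUnit_mul_self pos _)
      (gjUnit_anticomm pos ⟨by omega, by omega⟩ (by simp)) (gjUnit_comm_same pos _ _ _)
      (gjUnit_comm_same pos _ _ _) (gjUnit_anticomm pos ⟨by omega, by omega⟩ (by simp))
      (gjUnit_anticomm pos ⟨by omega, by omega⟩ (by simp)))
    (fun i j h => goldschmidtJones_comm (gjUnit_comm_same pos _ _ _) (gjUnit_comm_same pos _ _ _)
      (gjUnit_comm_far pos (by omega) (by simp)) (gjUnit_comm_far pos (by omega) (by simp)))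
    (fun i => goldschmidtJones_quad rootParam_six_sq (gjUnit_mul_self pos _)
      (gjUnit_mul_self pos _) (gjUnit_anticomm pos ⟨by omega, by omega⟩ (by simp)))

theorem gjRep_g (i : I) : gjRep pos (HeckeAlg.g pos _ i) = gjGen pos i :=
  HeckeAlg.lift_g ..

theorem gjGen_mem {S : Subalgebra ℂ (Module.End ℂ ((I × Bool →₀ ZMod 2) → ℂ))} (i : I)
    (h : ∀ b, gjUnit pos (i, b) ∈ S) : gjGen pos i ∈ S :=
  S.smul_mem (add_mem (add_mem (add_mem (one_mem S) (h false)) (h true))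
    (mul_mem (h false) (h true))) _

theorem gjRep_mem (x : HeckeAlg pos (rootParam 6)) : gjRep pos x ∈ Twisted.leftAlg (gjForm pos) := by
  have hx : x ∈ Algebra.adjoin ℂ (Set.range (HeckeAlg.g pos (rootParam 6))) :=
    HeckeAlg.adjoin_range_g pos _ ▸ Algebra.mem_top
  have h : Algebra.adjoin ℂ (Set.range (HeckeAlg.g pos (rootParam 6))) ≤
      (Twisted.leftAlg (gjForm pos)).comap (gjRep pos) := by
    refine Algebra.adjoin_le ?_
    rintro _ ⟨i, rfl⟩
    rw [SetLike.mem_coe, Subalgebra.mem_comap, gjRep_g]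
    exact gjGen_mem pos i fun b => gjUnit_mem pos _
  exact h hx

/-- The coefficient 1/2 of the identity is the Markov parameter; the remaining terms are nontrivial
translations at position `i`. -/
theorem gjRep_e (i : I) : gjRep pos (HeckeAlg.e pos _ i) =
    (1 / 2 : ℂ) • 1 - (rootParam 6 ^ 2 / (2 * (1 + rootParam 6))) •
      (gjUnit pos (i, false) + gjUnit pos (i, true) +
        gjUnit pos (i, false) * gjUnit pos (i, true)) := by
  have h0 := one_add_rootParam_six_ne_zero
  rw [HeckeAlg.e, map_smul, map_sub, AlgHom.commutes, gjRep_g, gjGen, goldschmidtJones,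
    Algebra.algebraMap_eq_smul_one]
  have h := rootParam_six_sq
  match_scalars
  · field_simp
    linear_combination -h
  all_goals field_simp

end Representation

/-! ### Existence of the Markov trace -/

section Existence

/-- The Markov trace obtained from the Goldschmidt–Jones representation. -/
theorem exists_markovTrace : ∃ t : MarkovTrace (rootParam 6) (1 / 2), ∀ x,
    t.tr x = Twisted.state (gjRep (fun i : ℕ => i) x) := by
  refine ⟨⟨Twisted.state.comp (gjRep (fun i : ℕ => i)).toLinearMap, ?_, ?_, ?_⟩, fun x => rfl⟩
  · simp [Twisted.state_one]
  · intro a b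
    simp only [LinearMap.comp_apply, AlgHom.toLinearMap_apply, map_mul]
    exact Twisted.state_mul_comm _ (gjRep_mem _ a) (gjRep_mem _ b)
  · intro m x
    simp only [LinearMap.comp_apply, AlgHom.toLinearMap_apply, map_mul]
    -- `H` consists of the vectors supported at positions below `m`. The generators of 𝓗_{m+1} have
    -- indices `0, …, m - 1`, so `x` acts through translations in `H`, while the nonscalar terms of
    -- the idempotent with index `m` lie outside.
    let H : AddSubgroup (ℕ × Bool →₀ ZMod 2) :=
      { carrier := {f | ∀ b, f (m, b) = 0 ∧ ∀ i, m < i → f (i, b) = 0}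
        add_mem' := fun hf hg b => ⟨by simp [(hf b).1, (hg b).1],
          fun i hi => by simp [(hf b).2 i hi, (hg b).2 i hi]⟩
        zero_mem' := fun b => ⟨rfl, fun _ _ => rfl⟩
        neg_mem' := fun hf b => ⟨by simp [(hf b).1], fun i hi => by simp [(hf b).2 i hi]⟩ }
    have hT : gjRep (fun i : ℕ => i) (heckeIncl (m + 1) (rootParam 6) x) ∈
        Algebra.adjoin ℂ (Twisted.left (gjForm fun i : ℕ => i) '' H) := by
      have hx : x ∈ Algebra.adjoin ℂ (Set.range (HeckeAlg.g _ (rootParam 6))) :=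
        HeckeAlg.adjoin_range_g _ _ ▸ Algebra.mem_top
      have h : Algebra.adjoin ℂ (Set.range (HeckeAlg.g _ (rootParam 6))) ≤
          (Algebra.adjoin ℂ (Twisted.left (gjForm fun i : ℕ => i) '' H)).comap
            ((gjRep fun i : ℕ => i).comp (heckeIncl (m + 1) (rootParam 6))) := by
        refine Algebra.adjoin_le ?_
        rintro _ ⟨i, rfl⟩
        rw [SetLike.mem_coe, Subalgebra.mem_comap, AlgHom.comp_apply, heckeIncl_g, gjRep_g]
        refine gjGen_mem _ _ fun b => Algebra.subset_adjoin ⟨_, ?_, rfl⟩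
        have hi := i.2
        intro b'
        refine ⟨Finsupp.single_eq_of_ne ?_, fun j hj => Finsupp.single_eq_of_ne ?_⟩ <;>
        · rw [ne_eq, Prod.mk.injEq]
          omega
      exact h hx
    generalize gjRep (fun i : ℕ => i) (heckeIncl (m + 1) (rootParam 6) x) = T at hT
    have h1 : ∀ b, Twisted.state (T * gjUnit (fun i : ℕ => i) (m, b)) = 0 := fun b =>
      Twisted.state_mul_left_eq_zero _ H hT fun h => by simpa using (h b).1
    have h2 : Twisted.state (T * (gjUnit (fun i : ℕ => i) (m, false) *
        gjUnit (fun i : ℕ => i) (m, true))) = 0 := by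
      rw [gjUnit, gjUnit, Twisted.left_mul_left, mul_smul_comm, map_smul,
        Twisted.state_mul_left_eq_zero _ H hT, smul_zero]
      intro h
      simpa using (h true).1
    rw [gjRep_e, mul_sub, mul_smul_comm, mul_smul_comm, mul_one, map_sub, map_smul, map_smul,
      mul_add T, mul_add T, map_add, map_add, h1, h1, h2]
    simp

end Existence

/-! ### Uniqueness of the Markov trace -/

section Uniqueness

variable {q : ℂ}

/-- The subalgebra of `𝓗_∞(q)` generated by the first `m` generators. -/
noncomputable def heckeInit (q : ℂ) (m : ℕ) : Subalgebra ℂ (HeckeInf q) :=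
  Algebra.adjoin ℂ (HeckeAlg.g (fun i : ℕ => i) q '' Set.Iio m)

theorem heckeInit_mono {m n : ℕ} (h : m ≤ n) : heckeInit q m ≤ heckeInit q n :=
  Algebra.adjoin_mono (Set.image_mono (Set.Iio_subset_Iio h))

theorem g_mem_heckeInit {i m : ℕ} (h : i < m) :
    HeckeAlg.g (fun i : ℕ => i) q i ∈ heckeInit q m :=
  Algebra.subset_adjoin ⟨i, h, rfl⟩

theorem heckeInit_le_range (m : ℕ) : heckeInit q m ≤ (heckeIncl (m + 1) q).range := by
  refine Algebra.adjoin_le ?_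
  rintro _ ⟨i, hi, rfl⟩
  exact ⟨HeckeAlg.g _ q ⟨i, hi⟩, heckeIncl_g (m + 1) q ⟨i, hi⟩⟩

theorem g_commute_heckeInit {m : ℕ} {x : HeckeInf q} (hx : x ∈ heckeInit q m) :
    HeckeAlg.g (fun i : ℕ => i) q (m + 1) * x = x * HeckeAlg.g (fun i : ℕ => i) q (m + 1) := by
  have h : heckeInit q m ≤ Subalgebra.centralizer ℂ {HeckeAlg.g (fun i : ℕ => i) q (m + 1)} := by
    refine Algebra.adjoin_le ?_
    rintro _ ⟨i, hi, rfl⟩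
    rw [SetLike.mem_coe, Subalgebra.mem_centralizer_iff]
    rintro _ rfl
    exact (HeckeAlg.g_comm (pos := fun i : ℕ => i) i (m + 1) (Nat.succ_lt_succ hi)).symm
  exact (Subalgebra.mem_centralizer_iff ℂ).1 (h hx) _ rfl

/-- The span of `A` and `A g_m A`, where `A` is generated by the first `m` generators. -/
noncomputable def heckeStep (q : ℂ) (m : ℕ) : Submodule ℂ (HeckeInf q) :=
  Submodule.span ℂ ((heckeInit q m : Set (HeckeInf q)) ∪
    {x | ∃ a ∈ heckeInit q m, ∃ b ∈ heckeInit q m,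
      x = a * HeckeAlg.g (fun i : ℕ => i) q m * b})

theorem mem_heckeStep_of_mem {m : ℕ} {x : HeckeInf q} (hx : x ∈ heckeInit q m) :
    x ∈ heckeStep q m :=
  Submodule.subset_span (Or.inl hx)

theorem mul_g_mul_mem_heckeStep {m : ℕ} {a b : HeckeInf q} (ha : a ∈ heckeInit q m)
    (hb : b ∈ heckeInit q m) : a * HeckeAlg.g (fun i : ℕ => i) q m * b ∈ heckeStep q m :=
  Submodule.subset_span (Or.inr ⟨a, ha, b, hb, rfl⟩)

theorem mul_mem_heckeStep {m : ℕ} {x y : HeckeInf q} (hx : x ∈ heckeStep q m)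
    (hy : y ∈ heckeInit q m) : x * y ∈ heckeStep q m := by
  induction hx using Submodule.span_induction with
  | mem x h =>
    rcases h with h | ⟨a, ha, b, hb, rfl⟩
    · exact mem_heckeStep_of_mem (mul_mem h hy)
    · rw [mul_assoc]
      exact mul_g_mul_mem_heckeStep ha (mul_mem hb hy)
  | zero => rw [zero_mul]; exact zero_mem _
  | add x z _ _ hx hz => rw [add_mul]; exact add_mem hx hz
  | smul c x _ hx => rw [smul_mul_assoc]; exact Submodule.smul_mem _ _ hx

/-- If `b` commutes with g_m, the quadratic relation removes the second g_m. Otherwise `h`, the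
induction hypothesis of `mem_heckeStep`, reduces to b = c g_n d with m = n + 1 and c, d commuting
with g_m, and the braid relation g_m g_n g_m = g_n g_m g_n leaves a single g_m. -/
theorem mul_g_mul_g_mem_heckeStep {m : ℕ} {a b : HeckeInf q} (ha : a ∈ heckeInit q m)
    (hb : b ∈ heckeInit q m) (h : ∀ n, m = n + 1 → b ∈ heckeStep q n) :
    a * HeckeAlg.g (fun i : ℕ => i) q m * b * HeckeAlg.g (fun i : ℕ => i) q m ∈
      heckeStep q m := by
  have hcomm : ∀ c ∈ heckeInit q m, HeckeAlg.g (fun i : ℕ => i) q m * c =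
      c * HeckeAlg.g (fun i : ℕ => i) q m →
      a * HeckeAlg.g (fun i : ℕ => i) q m * c * HeckeAlg.g (fun i : ℕ => i) q m ∈
        heckeStep q m := by
    intro c hc h
    rw [mul_assoc a, h, mul_assoc, mul_assoc c, HeckeAlg.g_sq, mul_add, mul_add, mul_smul_comm,
      mul_smul_comm, ← mul_assoc a, ← mul_one (a * c * _)]
    exact add_mem (Submodule.smul_mem _ _ (mul_g_mul_mem_heckeStep (mul_mem ha hc) (one_mem _)))
      (mem_heckeStep_of_mem (mul_mem ha (mul_mem hc (Subalgebra.algebraMap_mem _ _))))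
  cases m with
  | zero =>
    refine hcomm b hb ?_
    have hb' : b ∈ (⊥ : Subalgebra ℂ (HeckeInf q)) := by
      simpa [heckeInit] using hb
    obtain ⟨r, rfl⟩ := Algebra.mem_bot.1 hb'
    exact (Algebra.commutes r _).symm
  | succ n =>
    have hb' := h n rfl
    clear hb h
    induction hb' using Submodule.span_induction with
    | mem x h =>
      rcases h with h | ⟨c, hc, d, hd, rfl⟩
      · exact hcomm x (heckeInit_mono n.le_succ h) (g_commute_heckeInit h)
      · have hbr := HeckeAlg.g_braid (pos := fun i : ℕ => i) (q := q) n (n + 1) rfl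
        have key : a * HeckeAlg.g (fun i : ℕ => i) q (n + 1) *
            (c * HeckeAlg.g (fun i : ℕ => i) q n * d) * HeckeAlg.g (fun i : ℕ => i) q (n + 1) =
            a * c * HeckeAlg.g (fun i : ℕ => i) q n * HeckeAlg.g (fun i : ℕ => i) q (n + 1) *
              (HeckeAlg.g (fun i : ℕ => i) q n * d) := by
          calc _ = a * (HeckeAlg.g (fun i : ℕ => i) q (n + 1) * c) *
                HeckeAlg.g (fun i : ℕ => i) q n *
                (d * HeckeAlg.g (fun i : ℕ => i) q (n + 1)) := by simp only [mul_assoc]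
            _ = a * c * (HeckeAlg.g (fun i : ℕ => i) q (n + 1) *
                HeckeAlg.g (fun i : ℕ => i) q n * HeckeAlg.g (fun i : ℕ => i) q (n + 1)) * d := by
              rw [g_commute_heckeInit hc, ← g_commute_heckeInit hd]; simp only [mul_assoc]
            _ = _ := by rw [← hbr]; simp only [mul_assoc]
        rw [key]
        have hn := g_mem_heckeInit (q := q) n.lt_succ_self
        exact mul_g_mul_mem_heckeStep
          (mul_mem (mul_mem ha (heckeInit_mono n.le_succ hc)) hn)
          (mul_mem hn (heckeInit_mono n.le_succ hd))
    | zero => simp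
    | add x z _ _ hx hz => rw [mul_add, add_mul]; exact add_mem hx hz
    | smul c x _ hx =>
      rw [mul_smul_comm, smul_mul_assoc]; exact Submodule.smul_mem _ _ hx

/-- The span contains 1 and is stable under right multiplication by each of the first m + 1
generators; only g_m needs the induction. -/
theorem mem_heckeStep {m : ℕ} {x : HeckeInf q} (hx : x ∈ heckeInit q (m + 1)) :
    x ∈ heckeStep q m := by
  induction m using Nat.strong_induction_on generalizing x with
  | _ m ih =>
  have hg : ∀ p ∈ heckeStep q m, p * HeckeAlg.g (fun i : ℕ => i) q m ∈ heckeStep q m := by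
    intro p hp
    induction hp using Submodule.span_induction with
    | mem p h =>
      rcases h with h | ⟨a, ha, b, hb, rfl⟩
      · rw [← mul_one (p * _)]
        exact mul_g_mul_mem_heckeStep h (one_mem _)
      · exact mul_g_mul_g_mem_heckeStep ha hb fun n hn => ih n (by omega) (hn ▸ hb)
    | zero => rw [zero_mul]; exact zero_mem _
    | add a b _ _ ha hb => rw [add_mul]; exact add_mem ha hb
    | smul c a _ ha => rw [smul_mul_assoc]; exact Submodule.smul_mem _ _ ha
  have key : ∀ p ∈ heckeStep q m, p * x ∈ heckeStep q m := by
    have hx' : x ∈ Algebra.adjoin ℂ (HeckeAlg.g (fun i : ℕ => i) q '' Set.Iio (m + 1)) := hx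
    clear hx
    induction hx' using Algebra.adjoin_induction with
    | mem _ h =>
      obtain ⟨i, hi, rfl⟩ := h
      rcases Nat.lt_succ_iff_lt_or_eq.1 hi with h | rfl
      · exact fun p hp => mul_mem_heckeStep hp (g_mem_heckeInit h)
      · exact hg
    | algebraMap r => exact fun p hp => mul_mem_heckeStep hp (Subalgebra.algebraMap_mem _ _)
    | add a b _ _ ha hb => exact fun p hp => by rw [mul_add]; exact add_mem (ha p hp) (hb p hp)
    | mul a b _ _ ha hb => exact fun p hp => by rw [← mul_assoc]; exact hb _ (ha p hp)
  simpa using key 1 (mem_heckeStep_of_mem (one_mem _))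

theorem exists_mem_heckeInit (x : HeckeInf q) : ∃ m, x ∈ heckeInit q m := by
  have hx : x ∈ Algebra.adjoin ℂ (Set.range (HeckeAlg.g (fun i : ℕ => i) q)) :=
    HeckeAlg.adjoin_range_g _ q ▸ Algebra.mem_top
  induction hx using Algebra.adjoin_induction with
  | mem _ h =>
    obtain ⟨i, rfl⟩ := h
    exact ⟨i + 1, g_mem_heckeInit i.lt_succ_self⟩
  | algebraMap r => exact ⟨0, Subalgebra.algebraMap_mem _ _⟩
  | add a b _ _ ha hb =>
    obtain ⟨m, hm⟩ := ha
    obtain ⟨n, hn⟩ := hb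
    exact ⟨max m n, add_mem (heckeInit_mono (le_max_left m n) hm)
      (heckeInit_mono (le_max_right m n) hn)⟩
  | mul a b _ _ ha hb =>
    obtain ⟨m, hm⟩ := ha
    obtain ⟨n, hn⟩ := hb
    exact ⟨max m n, mul_mem (heckeInit_mono (le_max_left m n) hm)
      (heckeInit_mono (le_max_right m n) hn)⟩

theorem MarkovTrace.tr_mul_g {η : ℂ} (hq : 1 + q ≠ 0) (t : MarkovTrace q η) {m : ℕ}
    {x : HeckeInf q} (hx : x ∈ heckeInit q m) :
    t.tr (x * HeckeAlg.g (fun i : ℕ => i) q m) = (q - (1 + q) * η) * t.tr x := by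
  obtain ⟨y, rfl⟩ := heckeInit_le_range m hx
  have h := t.markov m y
  simp only [AlgHom.toRingHom_eq_coe, RingHom.coe_coe]
  rw [HeckeAlg.g_eq _ hq, mul_sub, map_sub, mul_smul_comm, map_smul, h,
    Algebra.algebraMap_eq_smul_one, mul_smul_comm, mul_one, map_smul, smul_eq_mul, smul_eq_mul]
  ring

/-- By cyclicity tr(a g_m b) = tr(b a g_m), a fixed multiple of tr(b a), so the values on each level
are determined by those on the previous one. -/
theorem MarkovTrace.eq {η : ℂ} (hq : 1 + q ≠ 0) (t t' : MarkovTrace q η) : t = t' := by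
  have key : ∀ m, ∀ x ∈ heckeInit q m, t.tr x = t'.tr x := by
    intro m
    induction m with
    | zero =>
      intro x hx
      have hx' : x ∈ (⊥ : Subalgebra ℂ (HeckeInf q)) := by simpa [heckeInit] using hx
      obtain ⟨r, rfl⟩ := Algebra.mem_bot.1 hx'
      rw [Algebra.algebraMap_eq_smul_one, map_smul, map_smul, t.tr_one, t'.tr_one]
    | succ m ih =>
      intro x hx
      have hx' := mem_heckeStep hx
      clear hx
      induction hx' using Submodule.span_induction with
      | mem x h =>
        rcases h with h | ⟨a, ha, b, hb, rfl⟩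
        · exact ih x h
        · rw [t.tr_mul_comm, t'.tr_mul_comm, ← mul_assoc, t.tr_mul_g hq (mul_mem hb ha),
            t'.tr_mul_g hq (mul_mem hb ha), ih _ (mul_mem hb ha)]
      | zero => rw [map_zero, map_zero]
      | add x y _ _ hx hy => rw [map_add, map_add, hx, hy]
      | smul c x _ hx => rw [map_smul, map_smul, hx]
  have htr : t.tr = t'.tr := LinearMap.ext fun x =>
    let ⟨m, hm⟩ := exists_mem_heckeInit x
    key m x hm
  cases t
  cases t'
  congr

end Uniqueness

/-! ### From infinitely many strands to n strands -/

section Comparison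

variable (n : ℕ)

/-- The positions of the generators of `𝓗_n`. -/
abbrev finPos (n : ℕ) : Fin (n - 1) → ℕ := fun i => i

/-- The trace lives on functions over infinitely many letters, whereas the inner product and the
separating vacuum need finitely many. Restriction intertwines the two models and preserves the
vacuum and the value at 0, hence the state. -/
theorem restrict_gjRep (x : HeckeFin n (rootParam 6)) (f : (ℕ × Bool →₀ ZMod 2) → ℂ) :
    Twisted.restrict (Prod.map (finPos n) id)
      (gjRep (fun i : ℕ => i) (heckeIncl n (rootParam 6) x) f) =
      gjRep (finPos n) x (Twisted.restrict (Prod.map (finPos n) id) f) := by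
  have hunit : ∀ a f, Twisted.restrict (Prod.map (finPos n) id)
      (gjUnit (fun i : ℕ => i) (Prod.map (finPos n) id a) f) =
      gjUnit (finPos n) a (Twisted.restrict (Prod.map (finPos n) id) f) := by
    intro a f
    rw [gjUnit, gjUnit, ← Twisted.restrict_left (c := gjForm (finPos n))
      (c' := gjForm fun i : ℕ => i) (ι := Prod.map (finPos n) id) (fun _ _ => rfl),
      Finsupp.mapDomain_single]
  have hx : x ∈ Algebra.adjoin ℂ (Set.range (HeckeAlg.g (finPos n) (rootParam 6))) :=
    HeckeAlg.adjoin_range_g _ _ ▸ Algebra.mem_top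
  induction hx using Algebra.adjoin_induction generalizing f with
  | mem _ h =>
    obtain ⟨i, rfl⟩ := h
    have h1 := fun b f => hunit (i, b) f
    simp only [Prod.map_apply, id] at h1
    rw [heckeIncl_g, gjRep_g, gjRep_g]
    simp only [gjGen, goldschmidtJones, LinearMap.smul_apply, LinearMap.add_apply, map_smul,
      map_add, Module.End.one_apply, Module.End.mul_apply, h1]
  | algebraMap r => simp [Algebra.algebraMap_eq_smul_one]
  | add a b _ _ ha hb => simp [ha, hb]
  | mul a b _ _ ha hb => simp [ha, hb]

theorem state_gjRep_heckeIncl (x : HeckeFin n (rootParam 6)) :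
    Twisted.state (gjRep (fun i : ℕ => i) (heckeIncl n (rootParam 6) x)) =
      Twisted.state (gjRep (finPos n) x) := by
  have hinj : Function.Injective (Prod.map (finPos n) (id : Bool → Bool)) :=
    Function.Injective.prodMap Fin.val_injective Function.injective_id
  rw [Twisted.state_apply, Twisted.state_apply, ← Twisted.restrict_vac hinj, ← restrict_gjRep,
    Twisted.restrict_apply, Finsupp.mapDomain_zero]

theorem MarkovTrace.tr_heckeIncl (t : MarkovTrace (rootParam 6) (etaParam 3 6))
    (x : HeckeFin n (rootParam 6)) :
    t.tr (heckeIncl n (rootParam 6) x) = Twisted.state (gjRep (finPos n) x) := by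
  obtain ⟨t', ht'⟩ : ∃ t : MarkovTrace (rootParam 6) (etaParam 3 6), ∀ x,
      t.tr x = Twisted.state (gjRep (fun i : ℕ => i) x) := by
    rw [etaParam_three_six]
    exact exists_markovTrace
  rw [t.eq one_add_rootParam_six_ne_zero t', ht', state_gjRep_heckeIncl]

end Comparison

/-! ### Positivity of the trace -/

section Hilbert

/-- The operators u, v and uv are skew-adjoint, and the coefficient q²/(2(1 + q)) is purely
imaginary, so their product is self-adjoint. -/
theorem sum_star_gjRep_e {I : Type} (pos : I → ℕ) [Fintype (I × Bool →₀ ZMod 2)] (i : I)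
    (f g : (I × Bool →₀ ZMod 2) → ℂ) :
    ∑ y, star (gjRep pos (HeckeAlg.e pos _ i) f y) * g y =
      ∑ y, star (f y) * gjRep pos (HeckeAlg.e pos _ i) g y := by
  have hu : ∀ b f g, ∑ y, star (gjUnit pos (i, b) f y) * g y =
      -∑ y, star (f y) * gjUnit pos (i, b) g y := by
    intro b f g
    rw [gjUnit, Twisted.sum_star_left_mul, Twisted.form_single,
      show gjForm pos (i, b) (i, b) = 1 by simp [gjForm, gjCocycle], zmodSign_one,
      ← Finset.sum_neg_distrib]
    simp
  have huv : ∑ y, star ((gjUnit pos (i, false) * gjUnit pos (i, true)) f y) * g y =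
      -∑ y, star (f y) * (gjUnit pos (i, false) * gjUnit pos (i, true)) g y := by
    rw [Module.End.mul_apply, hu, hu, neg_neg, ← Module.End.mul_apply,
      gjUnit_anticomm pos ⟨by omega, by omega⟩ (by simp)]
    simp
  have hc : star (rootParam 6 ^ 2 / (2 * (1 + rootParam 6))) =
      -(rootParam 6 ^ 2 / (2 * (1 + rootParam 6))) := by
    have h := rootParam_six_sq
    have h1 := one_add_rootParam_six_ne_zero
    have h2 : (1 : ℂ) + (1 - rootParam 6) ≠ 0 := by
      intro h2
      rw [show rootParam 6 = 2 by linear_combination -h2] at h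
      norm_num at h
    change starRingEnd ℂ _ = _
    simp only [map_div₀, map_pow, map_mul, map_add, map_one, map_ofNat, star_rootParam_six]
    rw [← neg_div, div_eq_div_iff (by simpa using h2) (by simpa using h1)]
    linear_combination 2 * h
  have h1 := hu false f g
  have h2 := hu true f g
  rw [gjRep_e]
  generalize rootParam 6 ^ 2 / (2 * (1 + rootParam 6)) = c at hc ⊢
  simp only [LinearMap.sub_apply, LinearMap.smul_apply, LinearMap.add_apply, Module.End.one_apply,
    Pi.sub_apply, Pi.smul_apply, Pi.add_apply, smul_eq_mul, star_sub, star_mul', star_add, hc,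
    sub_mul, mul_sub, add_mul, mul_add, Finset.sum_sub_distrib, Finset.sum_add_distrib,
    mul_assoc, mul_left_comm (star (f _)), ← Finset.mul_sum, h1, h2, huv]
  simp

variable (I : Type)

/-- The Hilbert space of the Goldschmidt–Jones representation. -/
abbrev GJSpace : Type := EuclideanSpace ℂ (I × Bool →₀ ZMod 2)

variable {I} (pos : I → ℕ)

/-- The Goldschmidt–Jones representation on a Hilbert space. -/
noncomputable def gjHilbert : HeckeAlg pos (rootParam 6) →ₐ[ℂ] Module.End ℂ (GJSpace I) :=
  (((WithLp.linearEquiv 2 ℂ ((I × Bool →₀ ZMod 2) → ℂ)).symm.conjAlgEquiv ℂ :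
    _ →ₐ[ℂ] Module.End ℂ (GJSpace I))).comp (gjRep pos)

theorem gjHilbert_apply (x : HeckeAlg pos (rootParam 6)) (f : GJSpace I) :
    gjHilbert pos x f = WithLp.toLp 2 (gjRep pos x f.ofLp) := rfl

variable [Fintype (I × Bool →₀ ZMod 2)]

theorem gjHilbert_e_isSymmetric (i : I) :
    (gjHilbert pos (HeckeAlg.e pos _ i)).IsSymmetric := by
  intro f g
  simpa [gjHilbert_apply, PiLp.inner_apply, mul_comm] using sum_star_gjRep_e pos i f.ofLp g.ofLp

theorem exists_adjoint_gjHilbert (x : HeckeAlg pos (rootParam 6)) :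
    ∃ x' : HeckeAlg pos (rootParam 6), ∀ f g,
      inner ℂ (gjHilbert pos x f) g = inner ℂ f (gjHilbert pos x' g) := by
  refine exists_adjoint_of_adjoin_eq_top (gjHilbert pos)
    (HeckeAlg.adjoin_range_e pos one_add_rootParam_six_ne_zero) ?_ x
  rintro _ ⟨i, rfl⟩
  exact gjHilbert_e_isSymmetric pos i

/-- Testing against the adjoint of `x` and using the trace property gives the squared norm of `x`
applied to the vacuum, and the vacuum is separating. -/
theorem gjRep_eq_zero_of_state [Finite I] {x : HeckeAlg pos (rootParam 6)}
    (h : ∀ y, Twisted.state (gjRep pos (x * y)) = 0) : gjRep pos x = 0 := by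
  obtain ⟨x', hx'⟩ := exists_adjoint_gjHilbert pos x
  refine Twisted.eq_zero_of_apply_vac (gjForm pos) (gjRep_mem pos x) ?_
  have h1 := h x'
  rw [map_mul, Twisted.state_mul_comm _ (gjRep_mem pos x) (gjRep_mem pos x')] at h1
  have h2 := hx' (WithLp.toLp 2 Twisted.vac) (gjHilbert pos x (WithLp.toLp 2 Twisted.vac))
  have h3 : inner ℂ (WithLp.toLp 2 Twisted.vac : GJSpace I)
      (gjHilbert pos x' (gjHilbert pos x (WithLp.toLp 2 Twisted.vac))) = 0 := by
    classical
    rw [← h1, gjHilbert_apply, gjHilbert_apply, EuclideanSpace.inner_toLp_toLp]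
    simp [Twisted.vac, Twisted.state_apply, dotProduct, Pi.single_apply]
  rw [h3, inner_self_eq_zero] at h2
  simpa [gjHilbert_apply] using h2

end Hilbert

/-! ### Semisimplicity of H_n(3,6) and existence of a Jones–Wenzl representation -/

namespace KLQuotient

variable (t : MarkovTrace (rootParam 6) (etaParam 3 6)) (n : ℕ)

theorem mem_ann_iff (x : HeckeFin n (rootParam 6)) : x ∈ t.ann n ↔ gjRep (finPos n) x = 0 := by
  have : x ∈ t.ann n ↔ ∀ y, t.tr (heckeIncl n _ (x * y)) = 0 := TwoSidedIdeal.mem_mk' ..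
  rw [this]
  constructor
  · intro h
    exact gjRep_eq_zero_of_state _ fun y => by rw [← t.tr_heckeIncl]; exact h y
  · intro h y
    rw [t.tr_heckeIncl, map_mul, h, zero_mul, map_zero]

theorem ann_rel_iff (x y : HeckeFin n (rootParam 6)) :
    (t.ann n).ringCon x y ↔ gjRep (finPos n) x = gjRep (finPos n) y := by
  rw [TwoSidedIdeal.rel_iff, mem_ann_iff, map_sub, sub_eq_zero]

/-- The faithful representation of `𝓗_n(3,6)` on the Goldschmidt–Jones Hilbert space. -/
noncomputable def toHilbert : KLQuotient t n →ₐ[ℂ] Module.End ℂ (GJSpace (Fin (n - 1))) :=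
  RingCon.liftₐ _ (gjHilbert (finPos n)) (by
    intro x y h
    have h' := (ann_rel_iff t n x y).1 h
    change gjHilbert _ x = gjHilbert _ y
    rw [gjHilbert, AlgHom.comp_apply, AlgHom.comp_apply, h'])

theorem mk_surjective : Function.Surjective (mk t n) :=
  RingCon.mk'_surjective _

theorem toHilbert_mk (x : HeckeFin n (rootParam 6)) :
    toHilbert t n (mk t n x) = gjHilbert (finPos n) x := rfl

theorem toHilbert_injective : Function.Injective (toHilbert t n) := by
  intro a b h
  obtain ⟨x, rfl⟩ := mk_surjective t n a
  obtain ⟨y, rfl⟩ := mk_surjective t n b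
  rw [toHilbert_mk, toHilbert_mk, gjHilbert, AlgHom.comp_apply, AlgHom.comp_apply] at h
  exact (RingCon.eq _).2 ((ann_rel_iff t n x y).2 (AlgEquiv.injective _ h))

/-- `mk` as a homomorphism of `ℂ`-algebras. -/
noncomputable def mkAlg : HeckeFin n (rootParam 6) →ₐ[ℂ] KLQuotient t n := (t.ann n).ringCon.mkₐ ℂ

theorem mkAlg_apply (x : HeckeFin n (rootParam 6)) : mkAlg t n x = mk t n x := rfl

theorem adjoin_range_e : Algebra.adjoin ℂ (Set.range (e t n)) = ⊤ := by
  have : Set.range (e t n) = mkAlg t n '' Set.range (HeckeAlg.e (finPos n) (rootParam 6)) := by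
    rw [← Set.range_comp]; rfl
  rw [this, ← AlgHom.map_adjoin, HeckeAlg.adjoin_range_e _ one_add_rootParam_six_ne_zero,
    Algebra.map_top, AlgHom.range_eq_top]
  exact mk_surjective t n

theorem e_mul_self (i : Fin (n - 1)) : e t n i * e t n i = e t n i := by
  rw [e, ← map_mul, HeckeAlg.e_mul_self _ one_add_rootParam_six_ne_zero]

theorem mk_g (i : Fin (n - 1)) : mk t n (HeckeAlg.g (finPos n) (rootParam 6) i) =
    algebraMap ℂ _ (rootParam 6) - (1 + rootParam 6) • e t n i := by
  rw [← mkAlg_apply, HeckeAlg.g_eq _ one_add_rootParam_six_ne_zero, map_sub, AlgHom.commutes,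
    map_smul]
  rfl

/-- The model is a faithful semisimple module, so it contains every simple module. A
multiplicity-free submodule with the inherited inner product is the required representation. -/
theorem isSemisimpleRing_and_exists_isJonesWenzl : IsSemisimpleRing (KLQuotient t n) ∧
    ∃ (V : Type) (_ : NormedAddCommGroup V) (_ : InnerProductSpace ℂ V)
      (_ : Module (KLQuotient t n) V) (_ : IsScalarTower ℂ (KLQuotient t n) V),
      IsJonesWenzl t n V := by
  let R := KLQuotient t n
  let K := GJSpace (Fin (n - 1))
  let _ : Module R K := Module.compHom K (toHilbert t n).toRingHom
  have hsmul : ∀ (r : R) (x : K), r • x = toHilbert t n r x := fun _ _ => rfl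
  have : IsScalarTower ℂ R K := ⟨fun c r x => by rw [hsmul, hsmul, map_smul]; rfl⟩
  have : FaithfulSMul R K := ⟨fun h => toHilbert_injective t n (LinearMap.ext h)⟩
  have hsa : ∀ i (x y : K), inner ℂ (e t n i • x) y = inner ℂ x (e t n i • y) :=
    fun i => gjHilbert_e_isSymmetric (finPos n) i
  have : IsSemisimpleModule R K := by
    refine isSemisimpleModule_of_selfAdjoint_generators (adjoin_range_e t n) ?_
    rintro _ ⟨i, rfl⟩
    exact hsa i
  have hR : IsSemisimpleRing R := isSemisimpleRing_of_faithful_module R K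
  have : IsNoetherian R K := isNoetherian_of_tower ℂ inferInstance
  obtain ⟨V, r, W, hW, hsimple, hdist, hall⟩ := exists_multiplicityFree_submodule R K
  let iN : NormedAddCommGroup V := Submodule.normedAddCommGroup (V.restrictScalars ℂ)
  let iI : InnerProductSpace ℂ V := Submodule.innerProductSpace (V.restrictScalars ℂ)
  let iM : Module R V := V.module
  have hVtower : IsScalarTower ℂ R V :=
    ⟨fun c r x => Subtype.ext (smul_assoc c r (x : K))⟩
  refine ⟨hR, V, iN, iI, iM, hVtower,
    @IsJonesWenzl.mk _ _ _ _ _ iN iI iM hVtower ?_ ?_ ⟨r, W, hW, hsimple, hdist, ?_⟩⟩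
  · exact inferInstanceAs (FiniteDimensional ℂ (V.restrictScalars ℂ))
  · exact fun i x y => hsa i x y
  · intro S _ _ hS
    obtain ⟨T, ⟨f⟩⟩ := exists_simple_submodule_of_faithful R K S
    obtain ⟨j, ⟨g⟩⟩ := hall T (IsSimpleModule.congr f.symm)
    exact ⟨j, ⟨f.trans g⟩⟩

end KLQuotient

/-! ### Groups normalizing a finite spanning set -/

section FiniteImage

/-- Moving `p` to the left past 1 + u + v + uv flips the signs of none or exactly two of u, v, uv.
Each such sign pattern is also produced by left multiplication by one of the four listed units `w`.
-/
theorem goldschmidtJones_conj {A : Type*} [Ring A] [Algebra ℂ A] (q : ℂ) {u v p : A}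
    (hu : u * u = -1) (hv : v * v = -1) (huv : v * u = -(u * v))
    (hup : u * p = p * u ∨ u * p = (-1 : ℂ) • (p * u))
    (hvp : v * p = p * v ∨ v * p = (-1 : ℂ) • (p * v)) :
    ∃ w, (w = 1 ∨ w = (-1 : ℂ) • u ∨ w = (-1 : ℂ) • v ∨ w = (-1 : ℂ) • (u * v)) ∧
      goldschmidtJones q u v * p = p * w * goldschmidtJones q u v := by
  simp only [neg_smul, one_smul] at hup hvp ⊢
  have h1 : ∀ x, u * (u * x) = -x := fun x => by rw [← mul_assoc, hu, neg_one_mul]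
  have h3 : ∀ x, v * (u * x) = -(u * (v * x)) := fun x => by
    rw [← mul_assoc, huv, neg_mul, mul_assoc]
  have hpu : ∀ {b : A}, u * p = b → ∀ x, u * (p * x) = b * x := fun h x => by rw [← mul_assoc, h]
  have key : ∀ w, (1 + u + v + u * v) * p = p * w * (1 + u + v + u * v) →
      goldschmidtJones q u v * p = p * w * goldschmidtJones q u v := by
    intro w h
    rw [goldschmidtJones, smul_mul_assoc, h, mul_smul_comm]
  rcases hup with h | h <;> rcases hvp with h' | h'
  · refine ⟨1, Or.inl rfl, key _ ?_⟩
    simp only [add_mul, mul_add, mul_assoc, h, h', hpu h, one_mul, mul_one]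
  · refine ⟨-(u * v), by simp, key _ ?_⟩
    simp only [add_mul, mul_add, mul_assoc, h, h', hpu h, one_mul, mul_one, mul_neg, neg_mul,
      neg_neg, hv, huv, hu, h1, h3]
    abel
  · refine ⟨-u, by simp, key _ ?_⟩
    simp only [add_mul, mul_add, mul_assoc, h, h', hpu h, one_mul, mul_one, mul_neg, neg_mul,
      neg_neg, hu, h1]
    abel
  · refine ⟨-v, by simp, key _ ?_⟩
    simp only [add_mul, mul_add, mul_assoc, h, h', hpu h, one_mul, mul_one, mul_neg, neg_mul,
      neg_neg, hv, huv, h3]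
    abel

/-- A group of units generated by finitely many elements of finite order is finite if it lies in the
algebra spanned by a finite set that it normalizes. -/
theorem finite_range_of_conj {A G : Type*} [Ring A] [Algebra ℂ A] [Group G] (f : G →* Aˣ)
    {S : Set G} (hS : S.Finite) (hgen : Subgroup.closure S = ⊤)
    (hfin : ∀ s ∈ S, IsOfFinOrder (f s)) {E : Set A} (hE : E.Finite)
    (hmem : ∀ x, (f x : A) ∈ Algebra.adjoin ℂ E)
    (hconj : ∀ s ∈ S, ∀ T ∈ E, (f s : A) * T * ((f s)⁻¹ : Aˣ) ∈ E) : Finite f.range := by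
  have hconj' : ∀ x : G, ∀ T ∈ E, (f x : A) * T * ((f x)⁻¹ : Aˣ) ∈ E := by
    intro x
    have hx : x ∈ Subgroup.closure S := hgen ▸ Subgroup.mem_top x
    induction hx using Subgroup.closure_induction with
    | mem s hs => exact hconj s hs
    | one => intro T hT; simpa using hT
    | mul x y _ _ hx hy =>
      intro T hT
      simpa [mul_assoc] using hx _ (hy T hT)
    | inv x _ hx =>
      intro T hT
      -- An injective self-map of the finite set `E` is onto, so the inverse conjugation preserves
      -- `E` as well.
      have : Finite E := hE
      let F : E → E := fun T => ⟨_, hx T T.2⟩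
      have hF : Function.Injective F := by
        intro T T' h
        have h' := congrArg Subtype.val h
        simp only [F] at h'
        exact Subtype.ext ((f x).isUnit.mul_right_injective
          ((f x)⁻¹.isUnit.mul_left_injective h'))
      obtain ⟨T', hT'⟩ := Finite.surjective_of_injective hF ⟨T, hT⟩
      have h' : (f x : A) * T' * ((f x)⁻¹ : Aˣ) = T := congrArg Subtype.val hT'
      rw [← h']
      simp [mul_assoc]
  have : Finite E := hE
  let F : f.range → E → E := fun γ T =>
    ⟨(γ : Aˣ) * T * ((γ : Aˣ)⁻¹ : Aˣ), by
      obtain ⟨_, x, rfl⟩ := γ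
      exact hconj' x T T.2⟩
  -- Elements acting alike on `E` differ by something commuting with `E`, hence with the algebra it
  -- generates, which contains the whole group. So the quotient by the centre injects into the
  -- self-maps of `E`.
  have hcenter : ∀ γ δ : f.range, F γ = F δ → γ⁻¹ * δ ∈ Subgroup.center f.range := by
    intro γ δ h
    have hcomm : ∀ T ∈ E, (((γ : Aˣ)⁻¹ * δ : Aˣ) : A) * T = T * ((γ : Aˣ)⁻¹ * δ : Aˣ) := by
      intro T hT
      have h' : ((γ : Aˣ) : A) * T * ((γ : Aˣ)⁻¹ : Aˣ) = ((δ : Aˣ) : A) * T * ((δ : Aˣ)⁻¹ : Aˣ) :=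
        congrArg Subtype.val (congrFun h ⟨T, hT⟩)
      calc (((γ : Aˣ)⁻¹ * δ : Aˣ) : A) * T
          = ((γ : Aˣ)⁻¹ : Aˣ) * (((δ : Aˣ) : A) * T * ((δ : Aˣ)⁻¹ : Aˣ)) * (δ : Aˣ) := by
            simp [mul_assoc]
        _ = _ := by rw [← h']; simp [mul_assoc]
    have hle : Algebra.adjoin ℂ E ≤ Subalgebra.centralizer ℂ {(((γ : Aˣ)⁻¹ * δ : Aˣ) : A)} := by
      refine Algebra.adjoin_le fun T hT => ?_
      rw [SetLike.mem_coe, Subalgebra.mem_centralizer_iff]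
      rintro _ rfl
      exact hcomm T hT
    rw [Subgroup.mem_center_iff]
    rintro ⟨_, x, rfl⟩
    exact Subtype.ext (Units.ext
      ((Subalgebra.mem_centralizer_iff ℂ).1 (hle (hmem x)) _ rfl).symm)
  have : (Subgroup.center f.range).FiniteIndex := by
    rw [Subgroup.finiteIndex_iff_finite_quotient]
    refine Finite.of_injective (fun a : f.range ⧸ Subgroup.center f.range => F a.out) ?_
    intro a b h
    rw [← a.out_eq, ← b.out_eq]
    exact QuotientGroup.eq.2 (hcenter _ _ h)
  refine Group.finite_of_finiteIndex_center (hS.image f.rangeRestrict) ?_ ?_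
  · rw [← MonoidHom.map_closure, hgen,
      Subgroup.map_top_of_surjective _ f.rangeRestrict_surjective]
  · rintro _ ⟨s, hs, rfl⟩
    exact (Subgroup.subtype_injective f.range).isOfFinOrder_iff.1 (hfin s hs)

end FiniteImage

/-! ### Finiteness of the braid image in H_n(3,6) -/

section BraidImage

/-- Both roots -1 and q of the quadratic relation have cube -1. -/
theorem HeckeAlg.g_pow_six {I : Type} (pos : I → ℕ) (i : I) :
    HeckeAlg.g pos (rootParam 6) i ^ 6 = 1 := by
  have h := rootParam_six_sq
  have h3 : HeckeAlg.g pos (rootParam 6) i ^ 3 = -1 := by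
    rw [pow_succ, pow_two, HeckeAlg.g_sq, add_mul, smul_mul_assoc, HeckeAlg.g_sq,
      Algebra.algebraMap_eq_smul_one, smul_one_mul]
    match_scalars
    · linear_combination h
    · linear_combination h
  rw [show 6 = 3 * 2 from rfl, pow_mul, h3, neg_one_sq]

theorem braidToHecke_of (n : ℕ) (q : ℂ) (hq : q ≠ 0) (i : Fin (n - 1)) :
    (braidToHecke n q hq (PresentedGroup.of i) : HeckeFin n q) = HeckeAlg.g _ q i := by
  rw [braidToHecke, PresentedGroup.toGroup.of]
  rfl

theorem isOfFinOrder_braidToHecke_of (n : ℕ) (i : Fin (n - 1)) :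
    IsOfFinOrder (braidToHecke n (rootParam 6) (rootParam_ne_zero 6) (PresentedGroup.of i)) := by
  rw [isOfFinOrder_iff_pow_eq_one]
  refine ⟨6, by norm_num, Units.ext ?_⟩
  rw [Units.val_pow_eq_pow_val, braidToHecke_of, HeckeAlg.g_pow_six, Units.val_one]

variable {I : Type} (pos : I → ℕ)

/-- The twisted translations up to sign. -/
def gjSigned : Set (Module.End ℂ ((I × Bool →₀ ZMod 2) → ℂ)) :=
  Set.range fun p : ZMod 2 × (I × Bool →₀ ZMod 2) =>
    zmodSign p.1 • Twisted.left (gjForm pos) p.2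

theorem gjSigned_finite [Finite I] : (gjSigned pos).Finite := by
  have : Finite (I × Bool →₀ ZMod 2) := Finite.of_injective _ DFunLike.coe_injective
  exact Set.finite_range _

theorem left_mem_gjSigned (x : I × Bool →₀ ZMod 2) :
    Twisted.left (gjForm pos) x ∈ gjSigned pos :=
  ⟨(0, x), by simp only [zmodSign_zero]; exact one_smul ℂ _⟩

theorem leftAlg_le_adjoin_gjSigned :
    Twisted.leftAlg (gjForm pos) ≤ Algebra.adjoin ℂ (gjSigned pos) := by
  refine Algebra.adjoin_mono ?_
  rintro _ ⟨x, rfl⟩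
  exact left_mem_gjSigned pos x

theorem zmodSign_smul_mem_gjSigned (a : ZMod 2) {T : Module.End ℂ ((I × Bool →₀ ZMod 2) → ℂ)}
    (hT : T ∈ gjSigned pos) : zmodSign a • T ∈ gjSigned pos := by
  obtain ⟨⟨b, x⟩, rfl⟩ := hT
  exact ⟨(a + b, x), by simp only [zmodSign_add, smul_smul]⟩

theorem neg_one_smul_mem_gjSigned {T : Module.End ℂ ((I × Bool →₀ ZMod 2) → ℂ)}
    (hT : T ∈ gjSigned pos) : (-1 : ℂ) • T ∈ gjSigned pos := by
  rw [← zmodSign_one]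
  exact zmodSign_smul_mem_gjSigned pos 1 hT

theorem mul_mem_gjSigned {S T : Module.End ℂ ((I × Bool →₀ ZMod 2) → ℂ)} (hS : S ∈ gjSigned pos)
    (hT : T ∈ gjSigned pos) : S * T ∈ gjSigned pos := by
  obtain ⟨⟨a, x⟩, rfl⟩ := hS
  obtain ⟨⟨b, y⟩, rfl⟩ := hT
  simp only [smul_mul_assoc, mul_smul_comm, Twisted.left_mul_left]
  exact zmodSign_smul_mem_gjSigned pos _ (zmodSign_smul_mem_gjSigned pos _
    (zmodSign_smul_mem_gjSigned pos _ (left_mem_gjSigned pos _)))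

theorem gjGen_conj_mem_gjSigned (i : I) {T : Module.End ℂ ((I × Bool →₀ ZMod 2) → ℂ)}
    (hT : T ∈ gjSigned pos) : ∃ T' ∈ gjSigned pos, gjGen pos i * T = T' * gjGen pos i := by
  have hu : ∀ b, gjUnit pos (i, b) ∈ gjSigned pos := fun b => left_mem_gjSigned pos _
  -- Any two translations commute up to sign, which is the input needed for `goldschmidtJones_conj`.
  have hcomm : ∀ b, gjUnit pos (i, b) * T = T * gjUnit pos (i, b) ∨
      gjUnit pos (i, b) * T = (-1 : ℂ) • (T * gjUnit pos (i, b)) := by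
    intro b
    obtain ⟨⟨a, x⟩, rfl⟩ := hT
    simp only [smul_mul_assoc, mul_smul_comm]
    rw [gjUnit, Twisted.left_mul_comm, smul_comm]
    rcases zmodSign_eq (Twisted.form (gjForm pos) (.single (i, b) 1) x +
      Twisted.form (gjForm pos) x (.single (i, b) 1)) with h | h <;> rw [h]
    · exact Or.inl (one_smul ℂ _)
    · exact Or.inr rfl
  obtain ⟨w, hw, h⟩ := goldschmidtJones_conj (rootParam 6) (gjUnit_mul_self pos (i, false))
    (gjUnit_mul_self pos (i, true)) (gjUnit_anticomm pos ⟨by omega, by omega⟩ (by simp))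
    (hcomm false) (hcomm true)
  refine ⟨T * w, mul_mem_gjSigned pos hT ?_, h⟩
  rcases hw with rfl | rfl | rfl | rfl
  · exact Twisted.left_zero (gjForm pos) ▸ left_mem_gjSigned pos 0
  · exact neg_one_smul_mem_gjSigned pos (hu _)
  · exact neg_one_smul_mem_gjSigned pos (hu _)
  · exact neg_one_smul_mem_gjSigned pos (mul_mem_gjSigned pos (hu _) (hu _))

/-- The Goldschmidt–Jones representation of `𝓗_n` as a homomorphism of monoids. -/
noncomputable abbrev gjRepHom (n : ℕ) : HeckeFin n (rootParam 6) →*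
    Module.End ℂ ((Fin (n - 1) × Bool →₀ ZMod 2) → ℂ) :=
  (gjRep (finPos n) : HeckeFin n (rootParam 6) →ₐ[ℂ] _)

/-- The braid group acts through a finite group in the Goldschmidt–Jones representation. -/
theorem finite_range_gjRep_braid (n : ℕ) :
    Finite ((Units.map (gjRepHom n)).comp
      (braidToHecke n (rootParam 6) (rootParam_ne_zero 6))).range := by
  refine finite_range_of_conj _ (Set.finite_range PresentedGroup.of)
    (PresentedGroup.closure_range_of _) ?_ (gjSigned_finite (finPos n))
    (fun x => leftAlg_le_adjoin_gjSigned _ (gjRep_mem _ _)) ?_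
  · rintro _ ⟨i, rfl⟩
    exact (Units.map (gjRepHom n)).isOfFinOrder (isOfFinOrder_braidToHecke_of n i)
  · rintro _ ⟨i, rfl⟩ T hT
    obtain ⟨T', hT', h⟩ := gjGen_conj_mem_gjSigned (finPos n) i hT
    rw [← gjRep_g] at h
    have hval : (((Units.map (gjRepHom n)).comp
        (braidToHecke n (rootParam 6) (rootParam_ne_zero 6)) (PresentedGroup.of i) : Units _) :
          Module.End ℂ _) = gjRep (finPos n) (HeckeAlg.g (finPos n) (rootParam 6) i) := by
      rw [← braidToHecke_of n _ (rootParam_ne_zero 6)]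
      rfl
    rw [← hval] at h
    rw [h, mul_assoc, Units.mul_inv, mul_one]
    exact hT'

/-- Since `toHilbert` is injective, finiteness may be checked on the Hilbert space, where the image
is the one in `gjRep` up to conjugation by an isomorphism. -/
theorem KLQuotient.finite_range_ofBraid (t : MarkovTrace (rootParam 6) (etaParam 3 6)) (n : ℕ) :
    (Set.range (KLQuotient.ofBraid t n)).Finite := by
  let F := Units.map (KLQuotient.toHilbert t n : KLQuotient t n →* Module.End ℂ (GJSpace (Fin (n - 1))))
  have hF : Function.Injective F := Units.map_injective (KLQuotient.toHilbert_injective t n)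
  refine Set.Finite.of_finite_image (f := F) ?_ hF.injOn
  have hfin := finite_range_gjRep_braid n
  let c : Module.End ℂ ((Fin (n - 1) × Bool →₀ ZMod 2) → ℂ) →ₐ[ℂ]
      Module.End ℂ (GJSpace (Fin (n - 1))) :=
    (WithLp.linearEquiv 2 ℂ ((Fin (n - 1) × Bool →₀ ZMod 2) → ℂ)).symm.conjAlgEquiv ℂ
  let C := Units.map (c : Module.End ℂ ((Fin (n - 1) × Bool →₀ ZMod 2) → ℂ) →*
    Module.End ℂ (GJSpace (Fin (n - 1))))
  refine (Set.Finite.image C (Set.toFinite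
    (((Units.map (gjRepHom n)).comp
      (braidToHecke n (rootParam 6) (rootParam_ne_zero 6))).range : Set _))).subset ?_
  rintro _ ⟨_, ⟨b, rfl⟩, rfl⟩
  exact ⟨_, ⟨b, rfl⟩, Units.ext rfl⟩

end BraidImage

/-! ### Properties of an arbitrary Jones–Wenzl representation -/

section JonesWenzl

variable {t : MarkovTrace (rootParam 6) (etaParam 3 6)} {n : ℕ} {V : Type*}
  [NormedAddCommGroup V] [InnerProductSpace ℂ V] [Module (KLQuotient t n) V]
  [IsScalarTower ℂ (KLQuotient t n) V]

/-- An element killing `V` kills every simple module, in particular every simple left ideal; by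
semisimplicity these sum to the whole ring, which contains 1. -/
theorem IsJonesWenzl.klRep_injective (h : IsJonesWenzl t n V) :
    Function.Injective (klRep t n V) := by
  rw [injective_iff_map_eq_zero]
  intro a ha
  have hV : ∀ x : V, a • x = 0 := fun x => LinearMap.congr_fun ha x
  have : IsSemisimpleRing (KLQuotient t n) :=
    (KLQuotient.isSemisimpleRing_and_exists_isJonesWenzl t n).1
  obtain ⟨r, W, -, -, -, hall⟩ := h.decomposition
  have hsimple : ∀ m : Submodule (KLQuotient t n) (KLQuotient t n),
      IsSimpleModule (KLQuotient t n) m → ∀ x ∈ m, a * x = 0 := by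
    intro m hm x hx
    obtain ⟨j, ⟨f⟩⟩ := hall m hm
    have h0 : a • (⟨x, hx⟩ : m) = 0 := by
      apply f.injective
      rw [map_smul, map_zero]
      exact Subtype.ext (hV _)
    exact congrArg Subtype.val h0
  have htop : (1 : KLQuotient t n) ∈ ⨆ m : {m : Submodule (KLQuotient t n) (KLQuotient t n) |
      IsSimpleModule (KLQuotient t n) m}, (m : Submodule (KLQuotient t n) (KLQuotient t n)) := by
    rw [← sSup_eq_iSup', IsSemisimpleModule.sSup_simples_eq_top]
    trivial
  have h1 : a * 1 = 0 := by
    refine Submodule.iSup_induction _ (motive := fun x => a * x = 0) htop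
      (fun m x hx => hsimple m m.2 x hx) (mul_zero a) fun x y hx hy => ?_
    rw [mul_add, hx, hy, add_zero]
  rwa [mul_one] at h1

/-- Each generator acts as q - (1 + q)e with e an orthogonal projection, that is, by q on the kernel
of e and by -1 on its range, both scalars of modulus 1. -/
theorem IsJonesWenzl.inner_braidRep (h : IsJonesWenzl t n V) (b : BraidGroup n) (x y : V) :
    inner ℂ ((braidRep t n V b : Module.End ℂ V) x) ((braidRep t n V b : Module.End ℂ V) y) =
      inner ℂ x y := by
  have hb : b ∈ Subgroup.closure (Set.range PresentedGroup.of) :=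
    PresentedGroup.closure_range_of {r | BraidRelator n r} ▸ Subgroup.mem_top b
  induction hb using Subgroup.closure_induction generalizing x y with
  | mem _ hs =>
    obtain ⟨i, rfl⟩ := hs
    have hg : ∀ x : V, (braidRep t n V (PresentedGroup.of i) : Module.End ℂ V) x =
        rootParam 6 • x - (1 + rootParam 6) • (KLQuotient.e t n i • x) := by
      intro x
      have : (braidRep t n V (PresentedGroup.of i) : Module.End ℂ V) x =
          KLQuotient.mk t n (braidToHecke n (rootParam 6) (rootParam_ne_zero 6)
            (PresentedGroup.of i) : HeckeFin n (rootParam 6)) • x := rfl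
      rw [this, braidToHecke_of, KLQuotient.mk_g, sub_smul, algebraMap_smul, smul_assoc]
    have he : inner ℂ (KLQuotient.e t n i • x) (KLQuotient.e t n i • y) =
        inner ℂ x (KLQuotient.e t n i • y) := by
      rw [h.selfAdjoint, smul_smul, KLQuotient.e_mul_self]
    rw [hg, hg]
    simp only [inner_sub_left, inner_sub_right, inner_smul_left, inner_smul_right, map_add, map_one,
      star_rootParam_six, he, h.selfAdjoint i x y]
    linear_combination (-inner ℂ x y + inner ℂ x (KLQuotient.e t n i • y)) * rootParam_six_sq
  | one => simp
  | mul a b _ _ ha hb =>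
    rw [map_mul, Units.val_mul, Module.End.mul_apply, Module.End.mul_apply, ha, hb]
  | inv a _ ha =>
    rw [← ha]
    simp only [← Module.End.mul_apply, ← Units.val_mul, ← map_mul, mul_inv_cancel, map_one,
      Units.val_one, Module.End.one_apply]

theorem finite_range_braidRep : Finite (braidRep t n V).range := by
  refine Set.Finite.subset ((KLQuotient.finite_range_ofBraid t n).image
    (Units.map (klRep t n V : KLQuotient t n →* Module.End ℂ V))) ?_
  rintro _ ⟨b, rfl⟩
  exact ⟨_, ⟨b, rfl⟩, rfl⟩

end JonesWenzl

theorem theorem3p1 :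
    etaParam 3 6 = 1 / 2 ∧
    (∃ t : MarkovTrace (rootParam 6) (etaParam 3 6), ∀ t', t' = t) ∧
    ∀ (t : MarkovTrace (rootParam 6) (etaParam 3 6)) (n : ℕ),
      (∃ (V : Type) (_ : NormedAddCommGroup V) (_ : InnerProductSpace ℂ V)
        (_ : Module (KLQuotient t n) V) (_ : IsScalarTower ℂ (KLQuotient t n) V),
        IsJonesWenzl t n V) ∧
      ∀ (V : Type*) [NormedAddCommGroup V] [InnerProductSpace ℂ V]
        [Module (KLQuotient t n) V] [IsScalarTower ℂ (KLQuotient t n) V],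
        IsJonesWenzl t n V →
          Function.Injective (klRep t n V) ∧
          (∀ (b : BraidGroup n) (x y : V),
            inner ℂ ((braidRep t n V b : Module.End ℂ V) x)
              ((braidRep t n V b : Module.End ℂ V) y) = inner ℂ x y) ∧
          Finite (braidRep t n V).range := by
  refine ⟨etaParam_three_six, ?_, fun t n =>
    ⟨(KLQuotient.isSemisimpleRing_and_exists_isJonesWenzl t n).2, ?_⟩⟩
  · obtain ⟨t, -⟩ := exists_markovTrace
    rw [etaParam_three_six]
    exact ⟨t, fun t' => t'.eq one_add_rootParam_six_ne_zero t⟩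
  · intro V _ _ _ _ h
    exact ⟨h.klRep_injective, h.inner_braidRep, finite_range_braidRep⟩
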